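/- **Theorem 1.2.** Let $X,Y$ be complex manifolds of complex dimensions $n$ and $m$ with smooth Hermitian metrics $\omega_g,\omega_h$, and let $f:X\to Y$ be a holomorphic map of rank $r$, i.e. $r$ is the maximum over $x\in X$ of the rank of the complex differential $\partial f_x:T^{1,0}_xX\to T^{1,0}_{f(x)}Y$. For a Hermitian metric with coefficients $g_{k\bar\ell}$ in local holomorphic coordinates let $T_{ij}^k$ be the components of the torsion $T(u,v)=\nabla_uv-\nabla_vu-[u,v]$ and $R_{i\bar jk\bar\ell}=g(\nabla_{\partial_i}\nabla_{\bar\partial_j}\partial_k-\nabla_{\bar\partial_j}\nabla_{\partial_i}\partial_k,\bar\partial_\ell)$ those of the curvature of the Chern connection $\nabla$. For $\tau\in(0,\infty)$ the tempered Ricci curvature is $$\mathrm{Ric}^\tau_{k\bar\ell}=g^{i\bar j}R_{i\bar jk\bar\ell}+\frac{1-1/\tau}{4}\,g^{p\bar q}g^{a\bar b}\,T_{pa}^i\,\overline{T_{qb}^j}\,g_{k\bar j}\,g_{i\bar\ell},$$ and, for a nonzero non-negative Hermitian $(1,1)$-tensor $\xi=(\xi^{\alpha\bar\beta})$, the tempered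 real bisectional curvature is $$\mathrm{RBC}^\tau_{\omega_h}(\xi)=\frac1{|\xi|^2_{\omega_h}}\sum_{\alpha,\beta,\gamma,\delta}\Big(R_{\alpha\bar\beta\gamma\bar\delta}-\frac{1-\tau}4\sum_{\rho,\sigma}T_{\alpha\gamma}^\rho\,\overline{T_{\beta\delta}^\sigma}\,h_{\rho\bar\sigma}\Big)\xi^{\alpha\bar\beta}\xi^{\gamma\bar\delta},$$ with $R,T$ the Chern curvature and torsion of $\omega_h$. Let $|\partial f|^2=\mathrm{tr}_{\omega_g}(f^*\omega_h)=g^{i\bar j}f_i^\alpha\overline{f_j^\beta}h_{\alpha\bar\beta}$ and $\Delta_{\omega_g}u=g^{i\bar j}\partial_i\partial_{\bar j}u$. Suppose there are constants $\tau\in(0,\infty)$, $C_1\in\mathbf R$ and $C_2,\kappa_0\ge0$ such that $$\mathrm{Ric}^\tau_{\omega_g}\ \ge\ -C_1\,\omega_g+C_2\,f^*\omega_h\quad\text{(as Hermitian forms at every point of }X),\qquad \mathrm{RBC}^\tau_{\omega_h}\ \le\ -\kappa_0\ \le\ 0$$ (at every point of $Y$ and for every nonzero non-negative Hermitian $\xi$).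 Then on $X$ $$\Delta_{\omega_g}|\partial f|^2\ \ge\ -C_1|\partial f|^2+\Big(\frac{\kappa_0}{r}+\frac{C_2}{n}\Big)|\partial f|^4 .$$ If, in addition, $X$ is compact and $\kappa_0n+rC_2>0$, then $$|\partial f|^2\ \le\ \frac{C_1\,r\,n}{\kappa_0n+rC_2}\quad\text{on }X.$$ (If $r=0$, then $\partial f=0$, and a quotient with denominator $r=0$ or $n=0$ in the first inequality is read as $0$.) -/

import Mathlib

open scoped Manifold ContDiff ComplexOrder

noncomputable section

namespace HermitianGeometry

/-- The Wirtinger derivative `∂F/∂zⁱ = ½ (∂F/∂xⁱ - √-1 ∂F/∂yⁱ)` of a function on `ℂⁿ`. -/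
def wirtinger {n : ℕ} (i : Fin n) (F : (Fin n → ℂ) → ℂ) (z : Fin n → ℂ) : ℂ :=
  (1 / 2) * (fderiv ℝ F z (Pi.single i 1) - Complex.I * fderiv ℝ F z (Pi.single i Complex.I))

/-- The conjugate Wirtinger derivative `∂F/∂z̄ⁱ = ½ (∂F/∂xⁱ + √-1 ∂F/∂yⁱ)`. -/
def wirtingerBar {n : ℕ} (i : Fin n) (F : (Fin n → ℂ) → ℂ) (z : Fin n → ℂ) : ℂ :=
  (1 / 2) * (fderiv ℝ F z (Pi.single i 1) + Complex.I * fderiv ℝ F z (Pi.single i Complex.I))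

/-- The holomorphic coordinate vector field `∂_k` of the chart `chartAt _ x₀`, at the point with
coordinates `z`. The complex tangent bundle of `X` is identified with `T^{1,0}X` as usual. -/
def coordField {n : ℕ} {X : Type*} [TopologicalSpace X] [ChartedSpace (Fin n → ℂ) X]
    (x₀ : X) (k : Fin n) (z : Fin n → ℂ) :
    TangentSpace 𝓘(ℂ, Fin n → ℂ) ((chartAt (Fin n → ℂ) x₀).symm z) :=
  mfderiv 𝓘(ℂ, Fin n → ℂ) 𝓘(ℂ, Fin n → ℂ) (chartAt (Fin n → ℂ) x₀).symm z
    (Pi.single k (1 : ℂ) : Fin n → ℂ)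

/-- A smooth Hermitian metric on a complex manifold `X` of dimension `n`: a positive definite
Hermitian form on each holomorphic tangent space (linear in the first and conjugate linear in the
second variable), whose coefficients in holomorphic coordinates are smooth in the real sense. -/
structure HermitianMetric (n : ℕ) (X : Type*) [TopologicalSpace X]
    [ChartedSpace (Fin n → ℂ) X] where
  form : ∀ x : X, TangentSpace 𝓘(ℂ, Fin n → ℂ) x →ₗ[ℂ]
    TangentSpace 𝓘(ℂ, Fin n → ℂ) x →ₗ⋆[ℂ] ℂ
  conj_symm : ∀ (x : X) (v w : TangentSpace 𝓘(ℂ, Fin n → ℂ) x),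
    (starRingEnd ℂ) (form x v w) = form x w v
  pos : ∀ (x : X) (v : TangentSpace 𝓘(ℂ, Fin n → ℂ) x), v ≠ 0 → 0 < (form x v v).re
  smooth : ∀ (x₀ : X) (k l : Fin n),
    ContDiffOn ℝ ∞
      (fun z => form ((chartAt (Fin n → ℂ) x₀).symm z) (coordField x₀ k z) (coordField x₀ l z))
      (chartAt (Fin n → ℂ) x₀).target

namespace HermitianMetric

variable {n : ℕ} {X : Type*} [TopologicalSpace X] [ChartedSpace (Fin n → ℂ) X]

/-- The coefficients `g_{k l̄} = g(∂_k, ∂_l̄)` in the chart at `x₀`. -/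
def coeff (g : HermitianMetric n X) (x₀ : X) (z : Fin n → ℂ) : Matrix (Fin n) (Fin n) ℂ :=
  fun k l => g.form ((chartAt (Fin n → ℂ) x₀).symm z) (coordField x₀ k z) (coordField x₀ l z)

/-- The inverse coefficients `g^{k l̄}`, normalized by `∑ l, g^{k l̄} g_{p l̄} = δ^k_p`. -/
def invCoeff (g : HermitianMetric n X) (x₀ : X) (z : Fin n → ℂ) : Matrix (Fin n) (Fin n) ℂ :=
  ((g.coeff x₀ z)⁻¹).transpose

/-- The Christoffel symbols `Γ_{ij}^k = g^{k l̄} ∂_i g_{j l̄}` of the Chern connection, that is, of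
the connection with `∇^{0,1} = ∂̄` for which `∂_i g(∂_j, ∂_l̄) = g(∇_i ∂_j, ∂_l̄)`. -/
def christoffel (g : HermitianMetric n X) (x₀ : X) (i j k : Fin n) (z : Fin n → ℂ) : ℂ :=
  ∑ l, g.invCoeff x₀ z k l * wirtinger i (fun w => g.coeff x₀ w j l) z

/-- The Chern covariant derivative `∇_{∂_i} w` of a (not necessarily holomorphic) vector field
`w = ∑ k, w^k ∂_k` of type `(1,0)`, in the chart at `x₀`. -/
def nabla (g : HermitianMetric n X) (x₀ : X) (i : Fin n) (w : (Fin n → ℂ) → (Fin n → ℂ)) :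
    (Fin n → ℂ) → (Fin n → ℂ) :=
  fun z k => wirtinger i (fun y => w y k) z + ∑ j, g.christoffel x₀ i j k z * w z j

/-- The Chern covariant derivative `∇_{∂_j̄} w = ∂̄_j w`. -/
def nablaBar (j : Fin n) (w : (Fin n → ℂ) → (Fin n → ℂ)) : (Fin n → ℂ) → (Fin n → ℂ) :=
  fun z k => wirtingerBar j (fun y => w y k) z

/-- The components `T_{ij}^k` of the Chern torsion `T(u,v) = ∇_u v - ∇_v u - [u,v]`, in the chart
at `x₀`; coordinate fields commute. -/
def torsion (g : HermitianMetric n X) (x₀ : X) (i j k : Fin n) (z : Fin n → ℂ) : ℂ :=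
  g.nabla x₀ i (fun _ => Pi.single j 1) z k - g.nabla x₀ j (fun _ => Pi.single i 1) z k

/-- The components `R_{i j̄ k l̄} = g(∇_i ∇_j̄ ∂_k - ∇_j̄ ∇_i ∂_k, ∂_l̄)` of the Chern curvature
tensor, in the chart at `x₀`; coordinate fields commute. -/
def curvature (g : HermitianMetric n X) (x₀ : X) (i j k l : Fin n) (z : Fin n → ℂ) : ℂ :=
  ∑ p, (g.nabla x₀ i (nablaBar j (fun _ => Pi.single k 1)) z p
      - nablaBar j (g.nabla x₀ i (fun _ => Pi.single k 1)) z p) * g.coeff x₀ z p l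

/-- The second Chern Ricci curvature `Ric^{(2)}_{k l̄} = g^{i j̄} R_{i j̄ k l̄}`. -/
def ricciTwo (g : HermitianMetric n X) (x₀ : X) (k l : Fin n) (z : Fin n → ℂ) : ℂ :=
  ∑ i, ∑ j, g.invCoeff x₀ z i j * g.curvature x₀ i j k l z

/-- The quadratic torsion term
`Q°_{k l̄} = g^{p q̄} g^{r s̄} T_{pr}^i conj(T_{qs}^j) g_{k j̄} g_{i l̄}`. -/
def torsionSq (g : HermitianMetric n X) (x₀ : X) (k l : Fin n) (z : Fin n → ℂ) : ℂ :=
  ∑ p, ∑ q, ∑ r, ∑ s, ∑ i, ∑ j,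
    g.invCoeff x₀ z p q * g.invCoeff x₀ z r s
      * g.torsion x₀ p r i z * (starRingEnd ℂ) (g.torsion x₀ q s j z)
      * g.coeff x₀ z k j * g.coeff x₀ z i l

/-- The tempered Ricci curvature `Ric^τ(v, v̄)` at `x`, as a Hermitian form on the tangent space;
its components `Ric^{(2)}_{k l̄} + ¼ (1 - 1/τ) Q°_{k l̄}` are taken in the chart at `x`, which is
the one that identifies the tangent space at `x` with `ℂⁿ`. -/
def temperedRicci (g : HermitianMetric n X) (τ : ℝ) (x : X) (v : Fin n → ℂ) : ℝ :=
  (∑ k, ∑ l, (g.ricciTwo x k l (chartAt (Fin n → ℂ) x x)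
      + (((1 - 1 / τ) / 4 : ℝ) : ℂ) * g.torsionSq x k l (chartAt (Fin n → ℂ) x x))
    * v k * (starRingEnd ℂ) (v l)).re

/-- The squared norm `|ξ|² = h_{α ν̄} h_{μ β̄} ξ^{α β̄} conj(ξ^{ν μ̄})` of a `(1,1)`-tensor at `x`,
given by its components in the chart at `x`. -/
def tensorNormSq (h : HermitianMetric n X) (x : X) (ξ : Matrix (Fin n) (Fin n) ℂ) : ℝ :=
  (∑ α, ∑ β, ∑ ν, ∑ μ,
    h.coeff x (chartAt (Fin n → ℂ) x x) α ν * h.coeff x (chartAt (Fin n → ℂ) x x) μ β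
      * ξ α β * (starRingEnd ℂ) (ξ ν μ)).re

/-- The tempered real bisectional curvature `RBC^τ(ξ)` at `x` of a `(1,1)`-tensor `ξ ≠ 0`, given by
its components in the chart at `x`. -/
def temperedRBC (h : HermitianMetric n X) (τ : ℝ) (x : X) (ξ : Matrix (Fin n) (Fin n) ℂ) : ℝ :=
  (∑ α, ∑ β, ∑ γ, ∑ δ,
    (h.curvature x α β γ δ (chartAt (Fin n → ℂ) x x)
      - (((1 - τ) / 4 : ℝ) : ℂ) * ∑ ρ, ∑ σ,
          h.torsion x α γ ρ (chartAt (Fin n → ℂ) x x)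
            * (starRingEnd ℂ) (h.torsion x β δ σ (chartAt (Fin n → ℂ) x x))
            * h.coeff x (chartAt (Fin n → ℂ) x x) ρ σ)
      * ξ α β * ξ γ δ).re / h.tensorNormSq x ξ

/-- The complex Laplacian `Δ u = g^{i j̄} ∂_i ∂_j̄ u` of a real function. -/
def laplacian (g : HermitianMetric n X) (u : X → ℝ) (x : X) : ℝ :=
  (∑ i, ∑ j, g.invCoeff x (chartAt (Fin n → ℂ) x x) i j
    * wirtinger i
        (wirtingerBar j (fun z => ((u ((chartAt (Fin n → ℂ) x).symm z) : ℝ) : ℂ)))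
        (chartAt (Fin n → ℂ) x x)).re

end HermitianMetric

section Maps

variable {n m : ℕ} {X Y : Type*} [TopologicalSpace X] [ChartedSpace (Fin n → ℂ) X]
  [TopologicalSpace Y] [ChartedSpace (Fin m → ℂ) Y]

/-- The complex differential `∂f : T^{1,0}_x X → T^{1,0}_{f x} Y` of a holomorphic map. -/
def differential (f : X → Y) (x : X) :
    TangentSpace 𝓘(ℂ, Fin n → ℂ) x →L[ℂ] TangentSpace 𝓘(ℂ, Fin m → ℂ) (f x) :=
  mfderiv 𝓘(ℂ, Fin n → ℂ) 𝓘(ℂ, Fin m → ℂ) f x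

/-- `f` has rank `r`: the largest rank of the complex differential of `f` is `r`. -/
def HasRank (f : X → Y) (r : ℕ) : Prop :=
  IsGreatest (Set.range fun x : X =>
    Module.finrank ℂ (LinearMap.range
      (differential (n := n) (m := m) f x :
        TangentSpace 𝓘(ℂ, Fin n → ℂ) x →ₗ[ℂ] TangentSpace 𝓘(ℂ, Fin m → ℂ) (f x)))) r

/-- The energy density `|∂f|² = g^{i j̄} h(∂f(∂_i), ∂f(∂_j))`, the trace of `f^* h` with respect
to `g`. -/
def energyDensity (g : HermitianMetric n X) (h : HermitianMetric m Y) (f : X → Y) (x : X) : ℝ :=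
  (∑ i : Fin n, ∑ j : Fin n, g.invCoeff x (chartAt (Fin n → ℂ) x x) i j
    * h.form (f x) (differential (n := n) (m := m) f x (Pi.single i (1 : ℂ) : Fin n → ℂ))
        (differential (n := n) (m := m) f x (Pi.single j (1 : ℂ) : Fin n → ℂ))).re

/-- The lower bound `Ric^τ_{ω_g} ≥ -C₁ ω_g + C₂ f^* ω_h`, as Hermitian forms at every point. -/
def TemperedRicciLowerBound (g : HermitianMetric n X) (h : HermitianMetric m Y) (f : X → Y)
    (τ C₁ C₂ : ℝ) : Prop :=
  ∀ (x : X) (v : TangentSpace 𝓘(ℂ, Fin n → ℂ) x),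
    -C₁ * (g.form x v v).re
        + C₂ * (h.form (f x) (differential (n := n) (m := m) f x v)
            (differential (n := n) (m := m) f x v)).re
      ≤ g.temperedRicci τ x v

/-- The upper bound `RBC^τ_{ω_h} ≤ c`: at every point, for all nonzero nonnegative Hermitian
`(1,1)`-tensors `ξ`. -/
def TemperedRBCUpperBound (h : HermitianMetric m Y) (τ c : ℝ) : Prop :=
  ∀ (y : Y) (ξ : Matrix (Fin m) (Fin m) ℂ), ξ.PosSemidef → ξ ≠ 0 → h.temperedRBC τ y ξ ≤ c

end Maps

end HermitianGeometry

end

/-! In charts let G and H be the coefficient matrices of the two metrics, K the transposed Jacobian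
of f, and P = K H K* the pulled back metric, so that |∂f|² = tr(G⁻¹P). Since K is holomorphic,
computing ∂̄_j ∂_i of this trace and contracting with g gives the Bochner formula: Δ|∂f|² equals
|∇∂f|², plus Ric⁽²⁾ paired with G⁻¹PG⁻¹, minus the curvature of h contracted twice with ξ, the
transpose of Ξ = K*G⁻¹K (`trace_bochner_identity`, `laplacian_energyDensity`).

Without a Kähler condition ∇_i f_k is not symmetric. The second derivatives of f cancel in ∇_i f_k −
∇_k f_i, which leaves x − y, with x the pullback of the torsion of h and y the image under ∂f of the
torsion of g (`hessianComp_antisymm`). The squared norm of a tensor is at least a quarter of that of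
its antisymmetrization (`quadForm_antisymm_le`), and |τx − y|² ≥ 0 gives |x − y|² ≥ (1 − τ)|x|² + (1
− 1/τ)|y|² (`le_quadForm_sub`). With the factor 1/4 these are exactly the torsion terms built into
RBC^τ and Ric^τ, so the two curvature bounds yield Δ|∂f|² ≥ −C₁|∂f|² + (κ₀ + C₂)|f*h|²
(`le_laplacian_energyDensity`).

Since P has rank at most r, Cauchy–Schwarz over the nonzero eigenvalues gives |∂f|⁴ ≤ r|f*h|²
(`trace_mul_sq_le_rank_mul`), and r ≤ n. On a compact X the inequality is evaluated at a maximum of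
|∂f|², where the Laplacian is nonpositive (`laplacian_nonpos_of_isLocalMax`), and divided by |∂f|².
-/

section

/-! ### Smoothness of holomorphic maps of several variables -/

open Metric Set Filter Topology MeasureTheory

/-- Directional derivatives of a holomorphic map of several variables are holomorphic. -/
theorem DifferentiableOn.differentiableAt_fderiv_apply_complex {E F : Type*}
    [NormedAddCommGroup E] [NormedSpace ℂ E] [FiniteDimensional ℂ E]
    [NormedAddCommGroup F] [NormedSpace ℂ F] [FiniteDimensional ℂ F]
    {f : E → F} {U : Set E} (hU : IsOpen U) (hf : DifferentiableOn ℂ f U) {z₀ : E}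
    (hz₀ : z₀ ∈ U) (v : E) : DifferentiableAt ℂ (fun z => fderiv ℂ f z v) z₀ := by
  have : CompleteSpace F := FiniteDimensional.complete ℂ F
  have : ProperSpace E := FiniteDimensional.proper ℂ E
  have hc : ContinuousAt f z₀ := (hf.differentiableAt (hU.mem_nhds hz₀)).continuousAt
  obtain ⟨ε, hε, hball⟩ : ∃ ε > 0, ball z₀ ε ⊆ U ∩ f ⁻¹' (ball (f z₀) 1) :=
    Metric.mem_nhds_iff.1 (inter_mem (hU.mem_nhds hz₀) (hc (ball_mem_nhds _ one_pos)))
  -- One ρ for moving the base point, one for the displacement `t • v` along the circle, one for the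
  -- ball in the Cauchy estimate.
  set ρ := ε / 3 with hρ
  have hρ0 : 0 < ρ := by positivity
  -- The numerator 2 appears because f stays within distance 1 of `f z₀` on the big ball, hence
  -- within 2 of `f w`.
  have hbound : ∀ w ∈ ball z₀ (2 * ρ), ‖fderiv ℂ f w‖ ≤ 2 / ρ := by
    intro w hw
    have hsub : ball w ρ ⊆ ball z₀ ε := by
      apply ball_subset_ball'
      have := mem_ball.1 hw
      linarith
    apply Complex.norm_fderiv_le_div_of_mapsTo_ball (hf.mono fun y hy => (hball (hsub hy)).1) _ hρ0
    intro y hy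
    have h1 := mem_ball.1 (hball (hsub hy)).2
    have h2 := mem_ball.1 (hball (hsub (mem_ball_self hρ0))).2
    rw [dist_comm] at h2
    have := dist_triangle (f y) (f z₀) (f w)
    rw [mem_closedBall]
    linarith
  -- The `+ 1` allows `v = 0`.
  set R := ρ / (‖v‖ + 1) with hR
  have hv : 0 < ‖v‖ + 1 := by positivity
  have hR0 : 0 < R := by positivity
  have hRv : R * ‖v‖ < ρ := by
    rw [hR, div_mul_eq_mul_div, div_lt_iff₀ hv]
    nlinarith
  have hin : ∀ z ∈ ball z₀ ρ, ∀ t : ℂ, ‖t‖ ≤ R → z + t • v ∈ ball z₀ (2 * ρ) := by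
    intro z hz t ht
    rw [mem_ball, dist_eq_norm] at hz ⊢
    have h1 : ‖t • v‖ ≤ R * ‖v‖ := by
      rw [norm_smul]; gcongr
    have h2 : z + t • v - z₀ = (z - z₀) + t • v := by abel
    rw [h2]
    have := norm_add_le (z - z₀) (t • v)
    linarith
  have h2U : ball z₀ (2 * ρ) ⊆ U := fun y hy => (hball (ball_subset_ball (by linarith) hy)).1
  have hdiff : ∀ w ∈ ball z₀ (2 * ρ), DifferentiableAt ℂ f w := fun w hw =>
    hf.differentiableAt (hU.mem_nhds (h2U hw))
  -- Cauchy's formula for the derivative of `t ↦ f (z + t • v)` at 0: the right side involves only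
  -- values of f, so it can be differentiated in z under the integral sign.
  have hcauchy : ∀ z ∈ ball z₀ ρ, fderiv ℂ f z v =
      ((2 * Real.pi * Complex.I : ℂ)⁻¹ • ∮ t in C(0, R), ((t - 0) ^ 2)⁻¹ • f (z + t • v)) := by
    intro z hz
    have hopen : IsOpen ((fun t : ℂ => z + t • v) ⁻¹' ball z₀ (2 * ρ)) :=
      isOpen_ball.preimage (by fun_prop)
    have hlin : ∀ t : ℂ, HasDerivAt (fun t : ℂ => z + t • v) v t := by
      intro t
      simpa using ((hasDerivAt_id t).smul_const v).const_add z
    rw [Complex.two_pi_I_inv_smul_circleIntegral_sub_sq_inv_smul_of_differentiable hopen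
      (fun t ht => hin z hz t (by simpa using ht)) _ (mem_ball_self hR0)]
    · have h0 : DifferentiableAt ℂ f (z + (0 : ℂ) • v) :=
        hdiff _ (hin z hz 0 (by simpa using hR0.le))
      have := (h0.hasFDerivAt.comp_hasDerivAt (0 : ℂ) (hlin 0)).deriv
      simp only [zero_smul, add_zero] at this
      exact this.symm
    · intro t ht
      exact (DifferentiableAt.comp t (hdiff _ ht) (hlin t).differentiableAt).differentiableWithinAt
  have hev : (fun z => fderiv ℂ f z v) =ᶠ[𝓝 z₀] fun z =>
      ((2 * Real.pi * Complex.I : ℂ)⁻¹ • ∮ t in C(0, R), ((t - 0) ^ 2)⁻¹ • f (z + t • v)) := by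
    filter_upwards [ball_mem_nhds z₀ hρ0] with z hz using hcauchy z hz
  refine DifferentiableAt.congr_of_eventuallyEq ?_ hev
  refine DifferentiableAt.const_smul ?_ _
  simp only [circleIntegral]
  have hcirc : ∀ θ, ‖circleMap 0 R θ‖ = R := fun θ => by simp [abs_of_pos hR0]
  have hcirc0 : ∀ θ, circleMap 0 R θ ≠ 0 := fun θ => by
    rw [← norm_pos_iff, hcirc]; exact hR0
  set c : ℝ → ℂ := fun θ => _root_.deriv (circleMap 0 R) θ * ((circleMap 0 R θ - 0) ^ 2)⁻¹ with hcdef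
  have hccont : Continuous c := by
    simp only [hcdef, deriv_circleMap, sub_zero]
    refine Continuous.mul (by fun_prop) (Continuous.inv₀ (by fun_prop) fun θ => ?_)
    exact pow_ne_zero _ (hcirc0 θ)
  have hsm : ∀ z θ, _root_.deriv (circleMap 0 R) θ • ((circleMap 0 R θ - 0) ^ 2)⁻¹ •
      f (z + circleMap 0 R θ • v) = c θ • f (z + circleMap 0 R θ • v) := fun z θ => by
    rw [smul_smul]
  simp only [hsm]
  have hfcont : ∀ z ∈ ball z₀ ρ, Continuous fun θ => c θ • f (z + circleMap 0 R θ • v) := by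
    intro z hz
    refine hccont.smul (continuous_iff_continuousAt.2 fun θ => ?_)
    have h1 := (hdiff _ (hin z hz (circleMap 0 R θ) (hcirc θ).le)).continuousAt
    have h2 : Continuous fun θ => z + circleMap 0 R θ • v := by fun_prop
    exact ContinuousAt.comp (f := fun θ => z + circleMap 0 R θ • v) h1 h2.continuousAt
  obtain ⟨B, hB⟩ : ∃ B, ∀ θ, ‖c θ‖ ≤ B := by
    refine ⟨R⁻¹, fun θ => ?_⟩
    have : ‖c θ‖ = R⁻¹ := by
      simp only [hcdef, deriv_circleMap, sub_zero, norm_mul, norm_inv, norm_pow, hcirc,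
        Complex.norm_I, mul_one]
      field_simp
    exact this.le
  refine (intervalIntegral.hasFDerivAt_integral_of_dominated_of_fderiv_le (𝕜 := ℂ)
    (F' := fun z θ => c θ • fderiv ℂ f (z + circleMap 0 R θ • v))
    (bound := fun _ => B * (2 / ρ))
    (ball_mem_nhds z₀ hρ0) ?_ ?_ ?_ ?_ ?_ ?_).differentiableAt
  · filter_upwards [ball_mem_nhds z₀ hρ0] with z hz
    exact (hfcont z hz).aestronglyMeasurable
  · exact (hfcont z₀ (mem_ball_self hρ0)).intervalIntegrable _ _
  -- Continuity of `fderiv ℂ f` is not yet known, so measurability of the differentiated integrand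
  -- comes from `measurable_fderiv`.
  · let _ : MeasurableSpace E := borel E
    have : BorelSpace E := ⟨rfl⟩
    have : FiniteDimensional ℂ (E →L[ℂ] F) := inferInstance
    have : ProperSpace (E →L[ℂ] F) := FiniteDimensional.proper ℂ _
    let _ : MeasurableSpace (E →L[ℂ] F) := borel (E →L[ℂ] F)
    have : BorelSpace (E →L[ℂ] F) := ⟨rfl⟩
    have h2 : Continuous fun θ => z₀ + circleMap 0 R θ • v := by fun_prop
    exact (hccont.stronglyMeasurable.smul
      ((measurable_fderiv ℂ f).comp h2.measurable).stronglyMeasurable).aestronglyMeasurable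
  · refine Eventually.of_forall fun θ _ z hz => ?_
    rw [norm_smul]
    have := hbound _ (hin z hz (circleMap 0 R θ) (hcirc θ).le)
    have := hB θ
    have hB0 : 0 ≤ B := (norm_nonneg _).trans this
    gcongr
  · exact continuous_const.intervalIntegrable _ _
  · refine Eventually.of_forall fun θ _ z hz => ?_
    have h1 := (hdiff _ (hin z hz (circleMap 0 R θ) (hcirc θ).le)).hasFDerivAt
    have h2 := h1.comp z ((hasFDerivAt_id z).add_const (circleMap 0 R θ • v))
    exact h2.const_smul (c θ)

/-- A holomorphic map of several variables is smooth. -/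
theorem DifferentiableOn.contDiffOn_complex {E F : Type*}
    [NormedAddCommGroup E] [NormedSpace ℂ E] [FiniteDimensional ℂ E]
    [NormedAddCommGroup F] [NormedSpace ℂ F] [FiniteDimensional ℂ F]
    {f : E → F} {U : Set E} (hU : IsOpen U) (hf : DifferentiableOn ℂ f U) :
    ContDiffOn ℂ ∞ f U := by
  rw [contDiffOn_infty]
  intro k
  -- Generalizing f lets the hypothesis apply to each directional derivative of f, which is again
  -- holomorphic.
  induction k generalizing f with
  | zero => exact contDiffOn_zero.2 hf.continuousOn
  | succ k ih =>
    push_cast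
    rw [contDiffOn_succ_iff_fderiv_of_isOpen hU]
    refine ⟨hf, by simp, ?_⟩
    rw [contDiffOn_clm_apply]
    exact fun v => ih fun z hz =>
      (hf.differentiableAt_fderiv_apply_complex hU hz v).differentiableWithinAt

end

/-! ### Wirtinger calculus for scalar functions -/

namespace HermitianGeometry

open Metric Set Filter Topology

/-- The first order operator `½ (∂/∂xⁱ + ε ∂/∂yⁱ)`, which is `∂/∂zⁱ` for `ε = -√-1` and `∂/∂z̄ⁱ` for
`ε = √-1`. -/
noncomputable def twistedDeriv {n : ℕ} (ε : ℂ) (i : Fin n) (φ : (Fin n → ℂ) → ℂ)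
    (z : Fin n → ℂ) : ℂ :=
  (1 / 2) * (fderiv ℝ φ z (Pi.single i 1) + ε * fderiv ℝ φ z (Pi.single i Complex.I))

theorem wirtinger_eq_twistedDeriv {n : ℕ} (i : Fin n) :
    wirtinger i = twistedDeriv (-Complex.I) i := by
  funext φ z
  simp only [wirtinger, twistedDeriv]
  ring

theorem wirtingerBar_eq_twistedDeriv {n : ℕ} (i : Fin n) :
    wirtingerBar i = twistedDeriv Complex.I i := rfl

section Scalar

variable {n : ℕ} {ε : ℂ} {i : Fin n} {φ ψ : (Fin n → ℂ) → ℂ} {z : Fin n → ℂ}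

theorem twistedDeriv_congr (hφ : φ =ᶠ[𝓝 z] ψ) : twistedDeriv ε i φ z = twistedDeriv ε i ψ z := by
  simp only [twistedDeriv, hφ.fderiv_eq]

theorem twistedDeriv_const (c : ℂ) : twistedDeriv ε i (fun _ => c) z = 0 := by
  simp [twistedDeriv]

theorem twistedDeriv_mul (hφ : DifferentiableAt ℝ φ z) (hψ : DifferentiableAt ℝ ψ z) :
    twistedDeriv ε i (fun w => φ w * ψ w) z =
      twistedDeriv ε i φ z * ψ z + φ z * twistedDeriv ε i ψ z := by
  simp only [twistedDeriv, fderiv_fun_mul hφ hψ, add_apply, smul_apply, smul_eq_mul]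
  ring

theorem twistedDeriv_add (hφ : DifferentiableAt ℝ φ z) (hψ : DifferentiableAt ℝ ψ z) :
    twistedDeriv ε i (fun w => φ w + ψ w) z = twistedDeriv ε i φ z + twistedDeriv ε i ψ z := by
  simp only [twistedDeriv, fderiv_fun_add hφ hψ, add_apply]
  ring

theorem twistedDeriv_neg :
    twistedDeriv ε i (fun w => -φ w) z = -twistedDeriv ε i φ z := by
  simp only [twistedDeriv, fderiv_fun_neg, neg_apply]
  ring

theorem twistedDeriv_sum {κ : Type*} (s : Finset κ) {Φ : κ → (Fin n → ℂ) → ℂ}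
    (hΦ : ∀ k ∈ s, DifferentiableAt ℝ (Φ k) z) :
    twistedDeriv ε i (fun w => ∑ k ∈ s, Φ k w) z = ∑ k ∈ s, twistedDeriv ε i (Φ k) z := by
  simp only [twistedDeriv, fderiv_fun_sum hΦ, sum_apply, Finset.mul_sum,
    ← Finset.sum_add_distrib]

theorem twistedDeriv_contDiffOn {U : Set (Fin n → ℂ)} (hU : IsOpen U)
    (hφ : ContDiffOn ℝ ∞ φ U) : ContDiffOn ℝ ∞ (twistedDeriv ε i φ) U := by
  have h := ((contDiffOn_infty_iff_fderiv_of_isOpen hU).1 hφ).2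
  exact contDiffOn_const.mul ((h.clm_apply contDiffOn_const).add
    (contDiffOn_const.mul (h.clm_apply contDiffOn_const)))

theorem wirtingerBar_conj :
    wirtingerBar i (fun w => (starRingEnd ℂ) (φ w)) z = (starRingEnd ℂ) (wirtinger i φ z) := by
  have h : fderiv ℝ (fun w => (starRingEnd ℂ) (φ w)) z =
      (Complex.conjCLE : ℂ →L[ℝ] ℂ).comp (fderiv ℝ φ z) :=
    Complex.conjCLE.comp_fderiv (f := φ)
  simp [wirtingerBar, wirtinger, h, map_ofNat, sub_eq_add_neg]

theorem wirtinger_conj :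
    wirtinger i (fun w => (starRingEnd ℂ) (φ w)) z = (starRingEnd ℂ) (wirtingerBar i φ z) := by
  have h : fderiv ℝ (fun w => (starRingEnd ℂ) (φ w)) z =
      (Complex.conjCLE : ℂ →L[ℝ] ℂ).comp (fderiv ℝ φ z) :=
    Complex.conjCLE.comp_fderiv (f := φ)
  simp [wirtingerBar, wirtinger, h, map_ofNat, sub_eq_add_neg]

theorem wirtinger_of_differentiableAt (hφ : DifferentiableAt ℂ φ z) :
    wirtinger i φ z = fderiv ℂ φ z (Pi.single i 1) := by
  have h1 : (Pi.single i Complex.I : Fin n → ℂ) = Complex.I • Pi.single i 1 := by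
    rw [← Pi.single_smul]; simp
  simp only [wirtinger, hφ.fderiv_restrictScalars ℝ, ContinuousLinearMap.coe_restrictScalars', h1,
    map_smul, smul_eq_mul]
  linear_combination (-1 / 2 * fderiv ℂ φ z (Pi.single i 1)) * Complex.I_mul_I

theorem wirtingerBar_of_differentiableAt (hφ : DifferentiableAt ℂ φ z) :
    wirtingerBar i φ z = 0 := by
  have h1 : (Pi.single i Complex.I : Fin n → ℂ) = Complex.I • Pi.single i 1 := by
    rw [← Pi.single_smul]; simp
  simp only [wirtingerBar, hφ.fderiv_restrictScalars ℝ, ContinuousLinearMap.coe_restrictScalars',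
    h1, map_smul, smul_eq_mul]
  linear_combination (1 / 2 * fderiv ℂ φ z (Pi.single i 1)) * Complex.I_mul_I

/-- A real linear functional with its complex linear part split off along the coordinates. -/
theorem realLinear_sub_I_mul {m : ℕ} (L : (Fin m → ℂ) →L[ℝ] ℂ) (v : Fin m → ℂ) :
    L v - Complex.I * L (Complex.I • v) =
      ∑ a, v a * (L (Pi.single a 1) - Complex.I * L (Pi.single a Complex.I)) := by
  -- This is twice the complex linear part of L; being complex linear, it is determined by its
  -- values on the standard basis.
  let T : (Fin m → ℂ) →ₗ[ℂ] ℂ :=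
    { toFun := fun w => L w - Complex.I * L (Complex.I • w)
      map_add' := fun x y => by simp only [smul_add, map_add]; ring
      map_smul' := fun c x => by
        have h1 : c • x = c.re • x + c.im • (Complex.I • x) := by
          ext k
          simp only [Pi.smul_apply, Pi.add_apply, smul_eq_mul, Complex.real_smul]
          linear_combination (-x k) * (Complex.re_add_im c)
        have h2 : Complex.I • (c • x) = c.re • (Complex.I • x) - c.im • x := by
          ext k
          simp only [Pi.smul_apply, Pi.sub_apply, smul_eq_mul, Complex.real_smul]
          linear_combination (-Complex.I * x k) * (Complex.re_add_im c) +
            c.im * x k * Complex.I_mul_I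
        have h3 := Complex.re_add_im c
        simp only [h2]
        rw [h1]
        simp only [map_add, map_sub, map_smul, Complex.real_smul, RingHom.id_apply, smul_eq_mul]
        linear_combination (L x - Complex.I * L (Complex.I • x)) * h3 +
          (c.im * L (Complex.I • x)) * Complex.I_mul_I }
  have hT : T v = ∑ a, v a * T (Pi.single a 1) := by
    conv_lhs => rw [pi_eq_sum_univ' v]
    simp only [map_sum, map_smul, smul_eq_mul]
  have h1 : ∀ a : Fin m, (Pi.single a Complex.I : Fin m → ℂ) = Complex.I • Pi.single a 1 := by
    intro a
    rw [← Pi.single_smul]; simp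
  simp only [h1]
  exact hT

/-- Conjugating L exchanges its complex linear and antilinear parts, so this is the previous
expansion for `conj ∘ L`. -/
theorem realLinear_add_I_mul {m : ℕ} (L : (Fin m → ℂ) →L[ℝ] ℂ) (v : Fin m → ℂ) :
    L v + Complex.I * L (Complex.I • v) = ∑ a, (starRingEnd ℂ) (v a) *
      (L (Pi.single a 1) + Complex.I * L (Pi.single a Complex.I)) := by
  have h := congrArg (starRingEnd ℂ)
    (realLinear_sub_I_mul ((Complex.conjCLE : ℂ →L[ℝ] ℂ).comp L) v)
  simpa using h

/-- Holomorphy of F removes the term with ∂̄φ from the chain rule; this is what makes curvature pull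
back as a tensor. -/
theorem wirtinger_comp {m : ℕ} {F : (Fin n → ℂ) → (Fin m → ℂ)} {φ : (Fin m → ℂ) → ℂ}
    (hF : DifferentiableAt ℂ F z) (hφ : DifferentiableAt ℝ φ (F z)) :
    wirtinger i (fun w => φ (F w)) z =
      ∑ a, fderiv ℂ F z (Pi.single i 1) a * wirtinger a φ (F z) := by
  have h1 : (Pi.single i Complex.I : Fin n → ℂ) = Complex.I • Pi.single i 1 := by
    rw [← Pi.single_smul]; simp
  have h := fderiv_comp z hφ (hF.restrictScalars ℝ)
  have h' : fderiv ℝ (fun w => φ (F w)) z = (fderiv ℝ φ (F z)).comp (fderiv ℝ F z) := h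
  simp only [wirtinger, h', ContinuousLinearMap.comp_apply, hF.fderiv_restrictScalars ℝ,
    ContinuousLinearMap.coe_restrictScalars', h1, map_smul]
  have h2 := realLinear_sub_I_mul (fderiv ℝ φ (F z)) (fderiv ℂ F z (Pi.single i 1))
  rw [h2, Finset.mul_sum]
  exact Finset.sum_congr rfl fun a _ => by ring

theorem wirtingerBar_comp {m : ℕ} {F : (Fin n → ℂ) → (Fin m → ℂ)} {φ : (Fin m → ℂ) → ℂ}
    (hF : DifferentiableAt ℂ F z) (hφ : DifferentiableAt ℝ φ (F z)) :
    wirtingerBar i (fun w => φ (F w)) z =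
      ∑ a, (starRingEnd ℂ) (fderiv ℂ F z (Pi.single i 1) a) * wirtingerBar a φ (F z) := by
  have h1 : (Pi.single i Complex.I : Fin n → ℂ) = Complex.I • Pi.single i 1 := by
    rw [← Pi.single_smul]; simp
  have h := fderiv_comp z hφ (hF.restrictScalars ℝ)
  have h' : fderiv ℝ (fun w => φ (F w)) z = (fderiv ℝ φ (F z)).comp (fderiv ℝ F z) := h
  simp only [wirtingerBar, h', ContinuousLinearMap.comp_apply, hF.fderiv_restrictScalars ℝ,
    ContinuousLinearMap.coe_restrictScalars', h1, map_smul]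
  have h2 := realLinear_add_I_mul (fderiv ℝ φ (F z)) (fderiv ℂ F z (Pi.single i 1))
  rw [h2, Finset.mul_sum]
  exact Finset.sum_congr rfl fun a _ => by ring

theorem fderiv_twistedDeriv_apply (hφ : ContDiffAt ℝ 2 φ z) (v : Fin n → ℂ) :
    fderiv ℝ (twistedDeriv ε i φ) z v =
      (1 / 2) * (fderiv ℝ (fderiv ℝ φ) z v (Pi.single i 1) +
        ε * fderiv ℝ (fderiv ℝ φ) z v (Pi.single i Complex.I)) := by
  have hd : DifferentiableAt ℝ (fderiv ℝ φ) z :=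
    (hφ.fderiv_right (m := 1) (by norm_num)).differentiableAt (by norm_num)
  have h1 : ∀ w : Fin n → ℂ, HasFDerivAt (fun y => fderiv ℝ φ y w)
      ((ContinuousLinearMap.apply ℝ ℂ w).comp (fderiv ℝ (fderiv ℝ φ) z)) z := fun w =>
    (ContinuousLinearMap.apply ℝ ℂ w).hasFDerivAt.comp z hd.hasFDerivAt
  have h2 := (((h1 (Pi.single i 1)).add ((h1 (Pi.single i Complex.I)).const_mul ε)).const_mul
    (1 / 2 : ℂ)).fderiv
  have h3 : fderiv ℝ (twistedDeriv ε i φ) z = _ := h2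
  rw [h3]
  simp [mul_add]

theorem twistedDeriv_comm {ε' : ℂ} {j : Fin n} (hφ : ContDiffAt ℝ 2 φ z) :
    twistedDeriv ε i (twistedDeriv ε' j φ) z = twistedDeriv ε' j (twistedDeriv ε i φ) z := by
  have hs : IsSymmSndFDerivAt ℝ φ z := hφ.isSymmSndFDerivAt (by simp)
  rw [twistedDeriv, twistedDeriv]
  simp only [fderiv_twistedDeriv_apply hφ]
  rw [hs.eq (Pi.single j 1) (Pi.single i 1), hs.eq (Pi.single j 1) (Pi.single i Complex.I),
    hs.eq (Pi.single j Complex.I) (Pi.single i 1),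
    hs.eq (Pi.single j Complex.I) (Pi.single i Complex.I)]
  ring

end Scalar

open Matrix
open scoped Kronecker

/-! ### Derivatives of matrix valued functions and of traces -/

section MatrixCalculus

variable {n : ℕ} {ε ε' : ℂ} {i j : Fin n} {U : Set (Fin n → ℂ)} {z : Fin n → ℂ}
  {ι κ l : Type*}

/-- The entrywise derivative of a matrix valued function. -/
noncomputable def matrixDeriv (ε : ℂ) (i : Fin n) (M : (Fin n → ℂ) → Matrix ι κ ℂ)
    (z : Fin n → ℂ) : Matrix ι κ ℂ :=
  Matrix.of fun a b => twistedDeriv ε i (fun w => M w a b) z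

/-- Smoothness of all entries of a matrix valued function on a set. -/
def MatrixSmoothOn (M : (Fin n → ℂ) → Matrix ι κ ℂ) (U : Set (Fin n → ℂ)) : Prop :=
  ∀ a b, ContDiffOn ℝ ∞ (fun w => M w a b) U

theorem MatrixSmoothOn.differentiableAt {M : (Fin n → ℂ) → Matrix ι κ ℂ} (hM : MatrixSmoothOn M U)
    (hU : IsOpen U) (hz : z ∈ U) (a : ι) (b : κ) : DifferentiableAt ℝ (fun w => M w a b) z :=
  ((hM a b).contDiffAt (hU.mem_nhds hz)).differentiableAt (by simp)

theorem MatrixSmoothOn.mul [Fintype κ] {M : (Fin n → ℂ) → Matrix ι κ ℂ} {N : (Fin n → ℂ) → Matrix κ l ℂ}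
    (hM : MatrixSmoothOn M U) (hN : MatrixSmoothOn N U) :
    MatrixSmoothOn (fun w => M w * N w) U := by
  intro a b
  simp only [Matrix.mul_apply]
  exact ContDiffOn.sum fun c _ => (hM a c).mul (hN c b)

theorem MatrixSmoothOn.matrixDeriv {M : (Fin n → ℂ) → Matrix ι κ ℂ} (hM : MatrixSmoothOn M U)
    (hU : IsOpen U) : MatrixSmoothOn (matrixDeriv ε i M) U :=
  fun a b => twistedDeriv_contDiffOn hU (hM a b)

theorem MatrixSmoothOn.neg {M : (Fin n → ℂ) → Matrix ι κ ℂ} (hM : MatrixSmoothOn M U) :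
    MatrixSmoothOn (fun w => -M w) U :=
  fun a b => (hM a b).neg

theorem MatrixSmoothOn.add {M N : (Fin n → ℂ) → Matrix ι κ ℂ} (hM : MatrixSmoothOn M U)
    (hN : MatrixSmoothOn N U) : MatrixSmoothOn (fun w => M w + N w) U :=
  fun a b => (hM a b).add (hN a b)

theorem MatrixSmoothOn.contDiffOn_trace [Fintype ι] {M : (Fin n → ℂ) → Matrix ι ι ℂ}
    (hM : MatrixSmoothOn M U) : ContDiffOn ℝ ∞ (fun w => (M w).trace) U :=
  ContDiffOn.sum fun a _ => hM a a

theorem MatrixSmoothOn.contDiffOn_det [Fintype ι] [DecidableEq ι] {M : (Fin n → ℂ) → Matrix ι ι ℂ}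
    (hM : MatrixSmoothOn M U) : ContDiffOn ℝ ∞ (fun w => (M w).det) U := by
  simp only [Matrix.det_apply']
  exact ContDiffOn.sum fun σ _ => contDiffOn_const.mul (contDiffOn_prod fun a _ => hM _ _)

/-- Cramer's rule: each entry is `det⁻¹` times the determinant of M with one row replaced by a
constant row. -/
theorem MatrixSmoothOn.inv [Fintype ι] [DecidableEq ι] {M : (Fin n → ℂ) → Matrix ι ι ℂ}
    (hM : MatrixSmoothOn M U) (hdet : ∀ w ∈ U, IsUnit (M w).det) :
    MatrixSmoothOn (fun w => (M w)⁻¹) U := by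
  intro a b
  simp only [Matrix.inv_def, Ring.inverse_eq_inv', Matrix.smul_apply, smul_eq_mul,
    Matrix.adjugate_apply]
  refine (hM.contDiffOn_det.inv fun w hw => (hdet w hw).ne_zero).mul ?_
  refine MatrixSmoothOn.contDiffOn_det fun c d => ?_
  by_cases hc : c = b
  · subst hc
    simpa [Matrix.updateRow_self] using contDiffOn_const
  · simpa [Matrix.updateRow_ne hc] using hM c d

theorem matrixDeriv_congr (hU : IsOpen U) (hz : z ∈ U) {M N : (Fin n → ℂ) → Matrix ι κ ℂ}
    (h : ∀ w ∈ U, M w = N w) : matrixDeriv ε i M z = matrixDeriv ε i N z := by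
  ext a b
  refine twistedDeriv_congr ?_
  filter_upwards [hU.mem_nhds hz] with w hw
  rw [h w hw]

theorem matrixDeriv_mul [Fintype κ] (hU : IsOpen U) (hz : z ∈ U) {M : (Fin n → ℂ) → Matrix ι κ ℂ}
    {N : (Fin n → ℂ) → Matrix κ l ℂ} (hM : MatrixSmoothOn M U) (hN : MatrixSmoothOn N U) :
    matrixDeriv ε i (fun w => M w * N w) z =
      matrixDeriv ε i M z * N z + M z * matrixDeriv ε i N z := by
  ext a b
  simp only [matrixDeriv, Matrix.mul_apply, Matrix.of_apply, Matrix.add_apply]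
  rw [twistedDeriv_sum _ fun c _ =>
    (hM.differentiableAt hU hz a c).fun_mul (hN.differentiableAt hU hz c b), ← Finset.sum_add_distrib]
  exact Finset.sum_congr rfl fun c _ =>
    twistedDeriv_mul (hM.differentiableAt hU hz a c) (hN.differentiableAt hU hz c b)

theorem matrixDeriv_add (hU : IsOpen U) (hz : z ∈ U) {M N : (Fin n → ℂ) → Matrix ι κ ℂ}
    (hM : MatrixSmoothOn M U) (hN : MatrixSmoothOn N U) :
    matrixDeriv ε i (fun w => M w + N w) z = matrixDeriv ε i M z + matrixDeriv ε i N z := by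
  ext a b
  exact twistedDeriv_add (hM.differentiableAt hU hz a b) (hN.differentiableAt hU hz a b)

theorem matrixDeriv_neg {M : (Fin n → ℂ) → Matrix ι κ ℂ} :
    matrixDeriv ε i (fun w => -M w) z = -matrixDeriv ε i M z := by
  ext a b
  exact twistedDeriv_neg

theorem matrixDeriv_const (C : Matrix ι κ ℂ) : matrixDeriv ε i (fun _ => C) z = 0 := by
  ext a b
  exact twistedDeriv_const _

theorem twistedDeriv_trace [Fintype ι] (hU : IsOpen U) (hz : z ∈ U) {M : (Fin n → ℂ) → Matrix ι ι ℂ}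
    (hM : MatrixSmoothOn M U) :
    twistedDeriv ε i (fun w => (M w).trace) z = (matrixDeriv ε i M z).trace :=
  twistedDeriv_sum _ fun a _ => hM.differentiableAt hU hz a a

theorem matrixDeriv_inv [Fintype ι] [DecidableEq ι] (hU : IsOpen U) (hz : z ∈ U)
    {M : (Fin n → ℂ) → Matrix ι ι ℂ} (hM : MatrixSmoothOn M U)
    (hdet : ∀ w ∈ U, IsUnit (M w).det) :
    matrixDeriv ε i (fun w => (M w)⁻¹) z = -((M z)⁻¹ * matrixDeriv ε i M z * (M z)⁻¹) := by
  have h1 := matrixDeriv_mul (ε := ε) (i := i) hU hz (hM.inv hdet) hM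
  have h2 : matrixDeriv ε i (fun w => (M w)⁻¹ * M w) z = 0 := by
    rw [matrixDeriv_congr hU hz (N := fun _ => 1) fun w hw => Matrix.nonsing_inv_mul _ (hdet w hw),
      matrixDeriv_const]
  rw [h2] at h1
  have h3 : matrixDeriv ε i (fun w => (M w)⁻¹) z * M z = -((M z)⁻¹ * matrixDeriv ε i M z) :=
    eq_neg_of_add_eq_zero_left h1.symm
  calc matrixDeriv ε i (fun w => (M w)⁻¹) z
      = matrixDeriv ε i (fun w => (M w)⁻¹) z * M z * (M z)⁻¹ := by
        rw [Matrix.mul_assoc, Matrix.mul_nonsing_inv _ (hdet z hz), Matrix.mul_one]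
    _ = _ := by rw [h3, Matrix.neg_mul]

/-- The algebraic identity behind the Bochner formula: the second derivative of the trace is a
square of covariant derivatives plus curvature terms. -/
theorem trace_bochner_identity {m' n' : Type*} [Fintype m'] [Fintype n'] [DecidableEq m']
    [DecidableEq n'] (g A B C : Matrix n' n' ℂ) (K K₁ : Matrix n' m' ℂ)
    (L L₂ : Matrix m' n' ℂ) (H Hi P Q R : Matrix m' m' ℂ) (h1 : Hi * H = 1) (h2 : H * Hi = 1) :
    (((g * B * g * A * g - g * C * g + g * A * g * B * g) * (K * (H * L)) +
      -(g * A * g) * (K * (Q * L + H * L₂))) +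
     ((-(g * B * g) * (K₁ * (H * L)) + g * (K₁ * (Q * L + H * L₂)))
      + (-(g * B * g) * (K * (P * L)) + g * (K * (R * L + P * L₂))))).trace =
    (g * (K₁ - A * g * K + K * (P * Hi)) * H * (L₂ - L * (g * B) + Hi * Q * L)).trace
      + (g * (-C + A * g * B) * g * (K * H * L)).trace
      - (g * K * (-R + P * Hi * Q) * L).trace := by
  -- In the application g = G⁻¹, A = ∂G, B = ∂̄G, C = ∂̄∂G, P = ∂H, Q = ∂̄H, R = ∂̄∂H, K₁ = ∂K and
  -- L₂ = ∂̄L. The two sides differ only by rotating the trailing factor `g * B` to the front.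
  have hc : ∀ X : Matrix n' n' ℂ, (X * (g * B)).trace = (g * B * X).trace := fun X =>
    Matrix.trace_mul_comm _ _
  have e1 : P * (Hi * H) = P := by rw [h1, Matrix.mul_one]
  have e2 : H * (Hi * Q) = Q := by rw [← Matrix.mul_assoc, h2, Matrix.one_mul]
  have expand : g * (K₁ - A * g * K + K * (P * Hi)) * H * (L₂ - L * (g * B) + Hi * Q * L) =
      g * K₁ * H * L₂ + g * K₁ * Q * L - g * A * g * K * H * L₂ - g * A * g * K * Q * L
      + g * K * P * L₂ + g * K * P * Hi * Q * L
      - (g * K₁ * H * L - g * A * g * K * H * L + g * K * P * L) * (g * B) := by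
    have e3 : ∀ X : Matrix m' n' ℂ, H * (Hi * X) = X := fun X => by
      rw [← Matrix.mul_assoc, h2, Matrix.one_mul]
    have e4 : ∀ X : Matrix m' n' ℂ, Hi * (H * X) = X := fun X => by
      rw [← Matrix.mul_assoc, h1, Matrix.one_mul]
    simp only [Matrix.mul_add, Matrix.add_mul, Matrix.mul_sub, Matrix.sub_mul, Matrix.mul_assoc,
      e3, e4]
    abel
  rw [expand, Matrix.trace_sub, hc]
  simp only [Matrix.mul_add, Matrix.add_mul, Matrix.mul_sub, Matrix.sub_mul, Matrix.mul_assoc,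
    Matrix.trace_add, Matrix.trace_sub, Matrix.trace_neg, Matrix.neg_mul, Matrix.mul_neg]
  ring

end MatrixCalculus

/-- The second derivative of the energy `tr (G⁻¹ K H L)`, for `K` holomorphic and `L`
antiholomorphic. -/
theorem twistedDeriv_twistedDeriv_trace {n : ℕ} {ε ε' : ℂ} {i j : Fin n} {U : Set (Fin n → ℂ)}
    {z : Fin n → ℂ} {n' m' : Type*} [Fintype n'] [Fintype m'] [DecidableEq n'] [DecidableEq m']
    (hU : IsOpen U) (hz : z ∈ U)
    {G : (Fin n → ℂ) → Matrix n' n' ℂ} {K : (Fin n → ℂ) → Matrix n' m' ℂ}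
    {H : (Fin n → ℂ) → Matrix m' m' ℂ} {L : (Fin n → ℂ) → Matrix m' n' ℂ}
    (hG : MatrixSmoothOn G U) (hK : MatrixSmoothOn K U) (hH : MatrixSmoothOn H U)
    (hL : MatrixSmoothOn L U) (hGdet : ∀ w ∈ U, IsUnit (G w).det)
    (hHdet : IsUnit (H z).det)
    (hK' : ∀ w ∈ U, matrixDeriv ε' j K w = 0) (hL' : ∀ w ∈ U, matrixDeriv ε i L w = 0)
    (hK'' : matrixDeriv ε' j (matrixDeriv ε i K) z = 0) :
    twistedDeriv ε' j (twistedDeriv ε i fun w => ((G w)⁻¹ * (K w * (H w * L w))).trace) z =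
      ((G z)⁻¹ * (matrixDeriv ε i K z - matrixDeriv ε i G z * (G z)⁻¹ * K z
          + K z * (matrixDeriv ε i H z * (H z)⁻¹)) * H z *
        (matrixDeriv ε' j L z - L z * ((G z)⁻¹ * matrixDeriv ε' j G z)
          + (H z)⁻¹ * matrixDeriv ε' j H z * L z)).trace
      + ((G z)⁻¹ * (-matrixDeriv ε' j (matrixDeriv ε i G) z
          + matrixDeriv ε i G z * (G z)⁻¹ * matrixDeriv ε' j G z) * (G z)⁻¹
            * (K z * H z * L z)).trace
      - ((G z)⁻¹ * K z * (-matrixDeriv ε' j (matrixDeriv ε i H) z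
          + matrixDeriv ε i H z * (H z)⁻¹ * matrixDeriv ε' j H z) * L z).trace := by
  have hg := hG.inv hGdet
  have hHL := hH.mul hL
  have hKHL := hK.mul hHL
  have hall := hg.mul hKHL
  have hG₁ := hG.matrixDeriv hU (ε := ε) (i := i)
  have hK₁ := hK.matrixDeriv hU (ε := ε) (i := i)
  have hH₁ := hH.matrixDeriv hU (ε := ε) (i := i)
  have hgGg := (hg.mul hG₁).mul hg
  -- No derivative of L appears because ∂L = 0. The formula is needed on all of U, since it is
  -- differentiated again.
  have first : ∀ w ∈ U, twistedDeriv ε i (fun w => ((G w)⁻¹ * (K w * (H w * L w))).trace) w =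
      (-((G w)⁻¹ * matrixDeriv ε i G w * (G w)⁻¹) * (K w * (H w * L w)) +
        ((G w)⁻¹ * (matrixDeriv ε i K w * (H w * L w)) +
          (G w)⁻¹ * (K w * (matrixDeriv ε i H w * L w)))).trace := by
    intro w hw
    rw [twistedDeriv_trace hU hw hall, matrixDeriv_mul hU hw hg hKHL, matrixDeriv_mul hU hw hK hHL,
      matrixDeriv_mul hU hw hH hL, matrixDeriv_inv hU hw hG hGdet, hL' w hw, Matrix.mul_zero,
      add_zero, Matrix.mul_add]
  rw [twistedDeriv_congr (Filter.eventuallyEq_of_mem (hU.mem_nhds hz) first)]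
  have t1 := hgGg.neg.mul hKHL
  have t2 := hg.mul (hK₁.mul hHL)
  have t3 := hg.mul (hK.mul (hH₁.mul hL))
  rw [twistedDeriv_trace hU hz (t1.add (t2.add t3)), matrixDeriv_add hU hz t1 (t2.add t3),
    matrixDeriv_add hU hz t2 t3, matrixDeriv_mul hU hz hgGg.neg hKHL,
    matrixDeriv_mul hU hz hg (hK₁.mul hHL), matrixDeriv_mul hU hz hg (hK.mul (hH₁.mul hL)),
    matrixDeriv_mul hU hz hK hHL, matrixDeriv_mul hU hz hK₁ hHL, matrixDeriv_mul hU hz hH hL,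
    matrixDeriv_mul hU hz hK (hH₁.mul hL), matrixDeriv_mul hU hz hH₁ hL, matrixDeriv_neg,
    matrixDeriv_mul hU hz (hg.mul hG₁) hg, matrixDeriv_mul hU hz hg hG₁,
    matrixDeriv_inv hU hz hG hGdet, hK' z hz, hK'', Matrix.zero_mul, Matrix.zero_mul, zero_add,
    zero_add, zero_add]
  rw [← trace_bochner_identity _ _ _ _ _ _ _ _ _ _ _ _ _ (Matrix.nonsing_inv_mul _ hHdet)
    (Matrix.mul_nonsing_inv _ hHdet)]
  congr 1
  noncomm_ring

/-! ### Chern connection, torsion and curvature in matrix form -/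

namespace HermitianMetric

variable {n : ℕ} {X : Type*} [TopologicalSpace X] [ChartedSpace (Fin n → ℂ) X]

theorem matrixSmoothOn_coeff (g : HermitianMetric n X) (x₀ : X) :
    MatrixSmoothOn (g.coeff x₀) (chartAt (Fin n → ℂ) x₀).target :=
  fun k l => g.smooth x₀ k l

/-- As matrices, Γ_i = ∂_iG · G⁻¹: the transpose in `invCoeff` places the inverse on the right. -/
theorem christoffel_eq (g : HermitianMetric n X) (x₀ : X) (i j k : Fin n) (z : Fin n → ℂ) :
    g.christoffel x₀ i j k z =
      (matrixDeriv (-Complex.I) i (g.coeff x₀) z * (g.coeff x₀ z)⁻¹) j k := by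
  simp only [christoffel, invCoeff, Matrix.transpose_apply, Matrix.mul_apply, matrixDeriv,
    Matrix.of_apply, wirtinger_eq_twistedDeriv]
  exact Finset.sum_congr rfl fun l _ => mul_comm _ _

theorem nabla_const_single (g : HermitianMetric n X) (x₀ : X) (i j k : Fin n) (z : Fin n → ℂ) :
    g.nabla x₀ i (fun _ => Pi.single j 1) z k = g.christoffel x₀ i j k z := by
  simp only [nabla, wirtinger_eq_twistedDeriv, twistedDeriv_const, zero_add]
  rw [Finset.sum_eq_single j] <;> simp +contextual

theorem torsion_eq (g : HermitianMetric n X) (x₀ : X) (i j k : Fin n) (z : Fin n → ℂ) :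
    g.torsion x₀ i j k z =
      (matrixDeriv (-Complex.I) i (g.coeff x₀) z * (g.coeff x₀ z)⁻¹) j k -
        (matrixDeriv (-Complex.I) j (g.coeff x₀) z * (g.coeff x₀ z)⁻¹) i k := by
  simp only [torsion, nabla_const_single, christoffel_eq]

/-- Coordinate fields are holomorphic, so only −∇_j̄∇_i∂_k survives and R = −∂̄_j(∂_iG · G⁻¹)G.
Expanding the derivative of G⁻¹ gives the familiar −∂̄∂G + ∂G · G⁻¹ · ∂̄G. -/
theorem curvature_eq (g : HermitianMetric n X) {x₀ : X} {z : Fin n → ℂ}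
    (hz : z ∈ (chartAt (Fin n → ℂ) x₀).target)
    (hdet : ∀ w ∈ (chartAt (Fin n → ℂ) x₀).target, IsUnit (g.coeff x₀ w).det)
    (i j k l : Fin n) :
    g.curvature x₀ i j k l z =
      (-matrixDeriv Complex.I j (matrixDeriv (-Complex.I) i (g.coeff x₀)) z
        + matrixDeriv (-Complex.I) i (g.coeff x₀) z * (g.coeff x₀ z)⁻¹
          * matrixDeriv Complex.I j (g.coeff x₀) z) k l := by
  have hU := (chartAt (Fin n → ℂ) x₀).open_target
  have hG := g.matrixSmoothOn_coeff x₀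
  have h1 : ∀ p, g.nabla x₀ i (nablaBar j (fun _ => Pi.single k 1)) z p = 0 := by
    intro p
    simp [nabla, nablaBar, wirtinger_eq_twistedDeriv, wirtingerBar_eq_twistedDeriv,
      twistedDeriv_const]
  have h2 : ∀ p, nablaBar j (g.nabla x₀ i (fun _ => Pi.single k 1)) z p =
      matrixDeriv Complex.I j
        (fun w => matrixDeriv (-Complex.I) i (g.coeff x₀) w * (g.coeff x₀ w)⁻¹) z k p := by
    intro p
    simp only [nablaBar, nabla_const_single, christoffel_eq, wirtingerBar_eq_twistedDeriv]
    rfl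
  have h3 : g.curvature x₀ i j k l z = (-matrixDeriv Complex.I j
      (fun w => matrixDeriv (-Complex.I) i (g.coeff x₀) w * (g.coeff x₀ w)⁻¹) z
        * g.coeff x₀ z) k l := by
    simp only [curvature, h1, h2, zero_sub]
    rfl
  rw [h3, matrixDeriv_mul hU hz (hG.matrixDeriv hU) (hG.inv hdet), matrixDeriv_inv hU hz hG hdet]
  have h4 : (g.coeff x₀ z)⁻¹ * g.coeff x₀ z = 1 := Matrix.nonsing_inv_mul _ (hdet z hz)
  simp only [Matrix.neg_mul, Matrix.add_mul, Matrix.mul_neg, Matrix.mul_assoc, h4, Matrix.mul_one,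
    neg_add, neg_neg]

end HermitianMetric

/-! ### Quadratic forms, trace pairings and the rank inequality -/

section LinearAlgebra

variable {ι κ : Type*} [Fintype ι] [Fintype κ]

/-- The real quadratic form of a square complex matrix. -/
noncomputable def quadForm (M : Matrix ι ι ℂ) (x : ι → ℂ) : ℝ := (star x ⬝ᵥ (M *ᵥ x)).re

theorem quadForm_nonneg {M : Matrix ι ι ℂ} (hM : M.PosSemidef) (x : ι → ℂ) : 0 ≤ quadForm M x :=
  (Complex.le_def.1 (hM.dotProduct_mulVec_nonneg x)).1

theorem quadForm_smul_sub (M : Matrix ι ι ℂ) (x y : ι → ℂ) (t : ℝ) :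
    quadForm M ((t : ℂ) • x - y) = t ^ 2 * quadForm M x + quadForm M y
      - t * (star x ⬝ᵥ (M *ᵥ y) + star y ⬝ᵥ (M *ᵥ x)).re := by
  simp only [quadForm, star_sub, star_smul, Matrix.mulVec_sub, Matrix.mulVec_smul,
    sub_dotProduct, dotProduct_sub, smul_dotProduct, dotProduct_smul, smul_eq_mul]
  simp
  ring

theorem quadForm_sub (M : Matrix ι ι ℂ) (x y : ι → ℂ) :
    quadForm M (x - y) = quadForm M x + quadForm M y
      - (star x ⬝ᵥ (M *ᵥ y) + star y ⬝ᵥ (M *ᵥ x)).re := by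
  have h := quadForm_smul_sub M x y 1
  simpa using h

/-- Dividing |τx − y|² ≥ 0 by τ bounds the cross term by τ|x|² + |y|²/τ. The parameter τ of the
tempered curvatures is the weight in this inequality. -/
theorem le_quadForm_sub {M : Matrix ι ι ℂ} (hM : M.PosSemidef) (x y : ι → ℂ) {τ : ℝ} (hτ : 0 < τ) :
    (1 - τ) * quadForm M x + (1 - 1 / τ) * quadForm M y ≤ quadForm M (x - y) := by
  have h1 := quadForm_nonneg hM ((τ : ℂ) • x - y)
  rw [quadForm_smul_sub] at h1
  rw [quadForm_sub]
  set c := (star x ⬝ᵥ (M *ᵥ y) + star y ⬝ᵥ (M *ᵥ x)).re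
  have h2 : c ≤ τ * quadForm M x + 1 / τ * quadForm M y := by
    have : c = 1 / τ * (τ * c) := by field_simp
    rw [this]
    have h3 : τ * quadForm M x + 1 / τ * quadForm M y =
        1 / τ * (τ ^ 2 * quadForm M x + quadForm M y) := by
      field_simp
    rw [h3]
    exact mul_le_mul_of_nonneg_left (by linarith) (by positivity)
  linarith

/-- Equivalent to |x + y|² ≥ 0, obtained from `quadForm_smul_sub` at t = −1. -/
theorem quadForm_sub_le {M : Matrix ι ι ℂ} (hM : M.PosSemidef) (x y : ι → ℂ) :
    quadForm M (x - y) ≤ 2 * quadForm M x + 2 * quadForm M y := by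
  have h1 := quadForm_nonneg hM (((-1 : ℝ) : ℂ) • x - y)
  rw [quadForm_smul_sub] at h1
  rw [quadForm_sub]
  linarith

theorem quadForm_mulVec (M : Matrix ι ι ℂ) (N : Matrix ι κ ℂ) (x : κ → ℂ) :
    quadForm M (N *ᵥ x) = quadForm (Nᴴ * M * N) x := by
  simp only [quadForm, Matrix.star_mulVec, ← Matrix.dotProduct_mulVec, Matrix.mulVec_mulVec,
    Matrix.mul_assoc]

theorem quadForm_eq_sum (M : Matrix ι ι ℂ) (x : ι → ℂ) :
    quadForm M x = (∑ p, ∑ q, (starRingEnd ℂ) (x p) * (M p q * x q)).re := by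
  simp only [quadForm, dotProduct, Matrix.mulVec, Finset.mul_sum, Pi.star_apply]
  rfl

theorem exists_eq_conjTranspose_mul_self [DecidableEq ι] {M : Matrix ι ι ℂ} (hM : M.PosSemidef) :
    ∃ B : Matrix ι ι ℂ, M = Bᴴ * B := by
  open scoped MatrixOrder in
  exact CStarAlgebra.nonneg_iff_eq_star_mul_self.mp hM.nonneg

variable [DecidableEq ι]

/-- The trace pairing of a nonnegative form with a positive semidefinite matrix is nonnegative. -/
theorem re_trace_mul_nonneg {A W : Matrix ι ι ℂ} (hW : W.PosSemidef)
    (hA : ∀ v : ι → ℂ, 0 ≤ (∑ k, ∑ l, A k l * v k * (starRingEnd ℂ) (v l)).re) :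
    0 ≤ (A * W).trace.re := by
  -- With W = B*B the trace becomes the sum of the form over the rows of B, so A itself need not be
  -- Hermitian.
  obtain ⟨B, rfl⟩ := exists_eq_conjTranspose_mul_self hW
  have h : (A * (Bᴴ * B)).trace =
      ∑ c, ∑ k, ∑ l, A k l * B c k * (starRingEnd ℂ) (B c l) := by
    rw [← Matrix.mul_assoc, Matrix.trace_mul_comm, ← Matrix.mul_assoc]
    refine Finset.sum_congr rfl fun c _ => ?_
    simp only [Matrix.diag_apply, Matrix.mul_apply, Matrix.conjTranspose_apply, Finset.sum_mul]
    rw [Finset.sum_comm]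
    refine Finset.sum_congr rfl fun k _ => Finset.sum_congr rfl fun l _ => ?_
    rw [starRingEnd_apply]
    ring
  rw [h, Complex.re_sum]
  exact Finset.sum_nonneg fun c _ => hA (B c)

/-- Cauchy–Schwarz on the nonzero eigenvalues, whose number is the rank. -/
theorem trace_sq_le_rank_mul {Q : Matrix ι ι ℂ} (hQ : Q.IsHermitian) {r : ℕ}
    (hr : Q.rank ≤ r) : Q.trace.re ^ 2 ≤ r * (Q * Q).trace.re := by
  have h1 : Q.trace.re = ∑ i, hQ.eigenvalues i := by
    rw [hQ.trace_eq_sum_eigenvalues]; simp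
  have h2 : (Q * Q).trace.re = ∑ i, hQ.eigenvalues i ^ 2 := by
    have h : Q * Q = Unitary.conjStarAlgAut ℂ _ hQ.eigenvectorUnitary
        (Matrix.diagonal (RCLike.ofReal ∘ hQ.eigenvalues) *
          Matrix.diagonal (RCLike.ofReal ∘ hQ.eigenvalues)) := by
      rw [map_mul, ← hQ.spectral_theorem]
    rw [h, Unitary.conjStarAlgAut_apply, Matrix.trace_mul_comm, ← Matrix.mul_assoc]
    simp [Matrix.diagonal_mul_diagonal, Matrix.trace_diagonal, sq]
  rw [h1, h2]
  have h3 : ∑ i, hQ.eigenvalues i =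
      ∑ i ∈ Finset.univ.filter (fun i => hQ.eigenvalues i ≠ 0), hQ.eigenvalues i :=
    (Finset.sum_filter_ne_zero _).symm
  have h4 : ((Finset.univ.filter (fun i => hQ.eigenvalues i ≠ 0)).card : ℝ) ≤ r := by
    rw [hQ.rank_eq_card_non_zero_eigs, Fintype.card_subtype] at hr
    exact_mod_cast hr
  rw [h3]
  refine sq_sum_le_card_mul_sum_sq.trans ?_
  refine mul_le_mul h4 ?_ (Finset.sum_nonneg fun _ _ => sq_nonneg _) (by positivity)
  exact Finset.sum_le_sum_of_subset_of_nonneg (Finset.filter_subset _ _)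
    fun _ _ _ => sq_nonneg _

/-- Writing g = B*B, the matrix BPB* is Hermitian, has rank at most that of P, and carries the same
two traces. -/
theorem trace_mul_sq_le_rank_mul {g P : Matrix ι ι ℂ} (hg : g.PosSemidef)
    (hP : P.IsHermitian) {r : ℕ} (hr : P.rank ≤ r) :
    (g * P).trace.re ^ 2 ≤ r * (P * (g * P * g)).trace.re := by
  obtain ⟨B, rfl⟩ := exists_eq_conjTranspose_mul_self hg
  have h1 : (B * P * Bᴴ).IsHermitian := Matrix.isHermitian_mul_mul_conjTranspose B hP
  have h2 : (B * P * Bᴴ).rank ≤ r :=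
    ((Matrix.rank_mul_le_left _ _).trans (Matrix.rank_mul_le_right _ _)).trans hr
  have h3 := trace_sq_le_rank_mul h1 h2
  have h4 : (B * P * Bᴴ).trace = (Bᴴ * B * P).trace := by
    rw [Matrix.trace_mul_comm, ← Matrix.mul_assoc]
  have h5 : (B * P * Bᴴ * (B * P * Bᴴ)).trace = (P * (Bᴴ * B * P * (Bᴴ * B))).trace := by
    simp only [Matrix.mul_assoc]
    rw [Matrix.trace_mul_comm]
    simp only [Matrix.mul_assoc]
  rwa [h4, h5] at h3

end LinearAlgebra

/-! ### Metrics and differentials in charts -/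

section Charts

variable {n m : ℕ} {X Y : Type*} [TopologicalSpace X] [ChartedSpace (Fin n → ℂ) X]
  [TopologicalSpace Y] [ChartedSpace (Fin m → ℂ) Y]

/-- The Hermitian form of a metric, as a form on `ℂⁿ`. -/
def HermitianMetric.formAt (g : HermitianMetric n X) (x : X) :
    (Fin n → ℂ) →ₗ[ℂ] (Fin n → ℂ) →ₗ⋆[ℂ] ℂ := g.form x

/-- The differential of the inverse of a chart, as a map of `ℂⁿ`. -/
noncomputable def chartSymmDeriv (x₀ : X) (z : Fin n → ℂ) : (Fin n → ℂ) →L[ℂ] (Fin n → ℂ) :=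
  mfderiv 𝓘(ℂ, Fin n → ℂ) 𝓘(ℂ, Fin n → ℂ) (chartAt (Fin n → ℂ) x₀).symm z

/-- The differential of a map, as a map `ℂⁿ → ℂᵐ`. -/
noncomputable def differentialAt (f : X → Y) (x : X) : (Fin n → ℂ) →L[ℂ] (Fin m → ℂ) :=
  differential (n := n) (m := m) f x

/-- The representative of a map in the charts at `x₀` and `f x₀`. -/
noncomputable def coordMap (f : X → Y) (x₀ : X) (z : Fin n → ℂ) : Fin m → ℂ :=
  chartAt (Fin m → ℂ) (f x₀) (f ((chartAt (Fin n → ℂ) x₀).symm z))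

/-- The set on which `coordMap` represents the map. -/
noncomputable def coordDomain (m : ℕ) [ChartedSpace (Fin m → ℂ) Y] (f : X → Y) (x₀ : X) : Set (Fin n → ℂ) :=
  (chartAt (Fin n → ℂ) x₀).target ∩
    (chartAt (Fin n → ℂ) x₀).symm ⁻¹' (f ⁻¹' (chartAt (Fin m → ℂ) (f x₀)).source)

theorem sesqForm_expand {ι : Type*} [Fintype ι] {V : Type*} [AddCommGroup V] [Module ℂ V]
    (B : V →ₗ[ℂ] V →ₗ⋆[ℂ] ℂ) (b : ι → V) (v w : ι → ℂ) :
    B (∑ k, v k • b k) (∑ k, w k • b k) =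
      ∑ k, ∑ l, B (b k) (b l) * v k * (starRingEnd ℂ) (w l) := by
  simp only [map_sum, LinearMap.sum_apply, map_smul, LinearMap.smul_apply, map_smulₛₗ, smul_eq_mul,
    Finset.mul_sum]
  rw [Finset.sum_comm]
  exact Finset.sum_congr rfl fun k _ => Finset.sum_congr rfl fun l _ => by ring

theorem sum_smul_single {p : ℕ} (v : Fin p → ℂ) : ∑ k, v k • (Pi.single k 1 : Fin p → ℂ) = v := by
  ext l
  simp [Finset.sum_apply, Pi.single_apply]

theorem HermitianMetric.coeff_apply (g : HermitianMetric n X) (x₀ : X) (z : Fin n → ℂ)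
    (k l : Fin n) : g.coeff x₀ z k l = g.formAt ((chartAt (Fin n → ℂ) x₀).symm z)
      (chartSymmDeriv x₀ z (Pi.single k 1)) (chartSymmDeriv x₀ z (Pi.single l 1)) := rfl

theorem HermitianMetric.formAt_chartSymmDeriv (g : HermitianMetric n X) (x₀ : X) (z : Fin n → ℂ)
    (v w : Fin n → ℂ) :
    g.formAt ((chartAt (Fin n → ℂ) x₀).symm z) (chartSymmDeriv x₀ z v) (chartSymmDeriv x₀ z w) =
      ∑ k, ∑ l, g.coeff x₀ z k l * v k * (starRingEnd ℂ) (w l) := by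
  conv_lhs => rw [← sum_smul_single v, ← sum_smul_single w]
  simp only [map_sum (chartSymmDeriv x₀ z), map_smul (chartSymmDeriv x₀ z)]
  rw [sesqForm_expand]
  rfl

section

variable [IsManifold 𝓘(ℂ, Fin n → ℂ) 1 X]

theorem chartSymmDeriv_injective {x₀ : X} {z : Fin n → ℂ}
    (hz : z ∈ (chartAt (Fin n → ℂ) x₀).target) : Function.Injective (chartSymmDeriv x₀ z) :=
  (mdifferentiable_chart (I := 𝓘(ℂ, Fin n → ℂ)) x₀).symm.mfderiv_injective hz

/-- The tangent space at `x₀` is identified with ℂⁿ through the preferred chart at `x₀`, so at its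
own centre that chart has identity differential. Hence the definitions in the chart at the point
agree with those in the standard basis. -/
theorem chartSymmDeriv_self (x₀ : X) (v : Fin n → ℂ) :
    chartSymmDeriv x₀ (chartAt (Fin n → ℂ) x₀ x₀) v = v := by
  have h1 := (mdifferentiable_chart (I := 𝓘(ℂ, Fin n → ℂ)) x₀).symm_comp_deriv
    (mem_chart_source _ x₀)
  rw [mfderiv_chartAt_eq_tangentCoordChange (mem_chart_source _ x₀)] at h1
  have h2 := DFunLike.congr_fun h1 v
  have h3 : tangentCoordChange 𝓘(ℂ, Fin n → ℂ) x₀ x₀ x₀ v = v :=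
    tangentCoordChange_self (by simp)
  have h4 : chartSymmDeriv x₀ (chartAt (Fin n → ℂ) x₀ x₀)
    (tangentCoordChange 𝓘(ℂ, Fin n → ℂ) x₀ x₀ x₀ v) = v := h2
  rwa [h3] at h4

theorem HermitianMetric.coeff_posDef (g : HermitianMetric n X) {x₀ : X} {z : Fin n → ℂ}
    (hz : z ∈ (chartAt (Fin n → ℂ) x₀).target) : (g.coeff x₀ z).PosDef := by
  have hherm : (g.coeff x₀ z).IsHermitian := by
    ext k l
    exact g.conj_symm _ _ _
  refine Matrix.PosDef.of_dotProduct_mulVec_pos hherm fun v hv => ?_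
  -- The metric is linear in its first slot, whereas `star v ⬝ᵥ G *ᵥ v` conjugates the first vector;
  -- hence the form is evaluated at `star v`.
  have hv' : star v ≠ 0 := by simpa using hv
  have h1 : star v ⬝ᵥ (g.coeff x₀ z *ᵥ v) =
      g.formAt ((chartAt (Fin n → ℂ) x₀).symm z) (chartSymmDeriv x₀ z (star v))
        (chartSymmDeriv x₀ z (star v)) := by
    rw [g.formAt_chartSymmDeriv]
    simp only [dotProduct, Matrix.mulVec, Finset.mul_sum, Pi.star_apply]
    refine Finset.sum_congr rfl fun k _ => Finset.sum_congr rfl fun l _ => ?_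
    simp
    ring
  have h2 : chartSymmDeriv x₀ z (star v) ≠ 0 := fun h =>
    hv' (chartSymmDeriv_injective hz (h.trans (map_zero _).symm))
  rw [h1, Complex.lt_def]
  refine ⟨g.pos _ _ h2, ?_⟩
  have := g.conj_symm ((chartAt (Fin n → ℂ) x₀).symm z) (chartSymmDeriv x₀ z (star v))
    (chartSymmDeriv x₀ z (star v))
  exact (Complex.conj_eq_iff_im.1 this).symm

theorem HermitianMetric.isUnit_det_coeff (g : HermitianMetric n X) {x₀ : X} {z : Fin n → ℂ}
    (hz : z ∈ (chartAt (Fin n → ℂ) x₀).target) : IsUnit (g.coeff x₀ z).det :=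
  (Matrix.isUnit_iff_isUnit_det _).1 (g.coeff_posDef hz).isUnit

theorem HermitianMetric.coeff_self (g : HermitianMetric n X) (x : X) (k l : Fin n) :
    g.coeff x (chartAt (Fin n → ℂ) x x) k l =
      g.formAt x (Pi.single k 1) (Pi.single l 1) := by
  rw [g.coeff_apply, chartSymmDeriv_self, chartSymmDeriv_self,
    (chartAt (Fin n → ℂ) x).left_inv (mem_chart_source _ x)]

end

theorem isOpen_coordDomain {f : X → Y} (hf : Continuous f) (x₀ : X) :
    IsOpen (coordDomain (n := n) m f x₀) :=
  (chartAt (Fin n → ℂ) x₀).isOpen_inter_preimage_symm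
    ((chartAt (Fin m → ℂ) (f x₀)).open_source.preimage hf)

theorem mem_coordDomain_self (f : X → Y) (x₀ : X) :
    chartAt (Fin n → ℂ) x₀ x₀ ∈ coordDomain (n := n) m f x₀ := by
  refine ⟨mem_chart_target _ x₀, ?_⟩
  simp only [mem_preimage, (chartAt (Fin n → ℂ) x₀).left_inv (mem_chart_source _ x₀)]
  exact mem_chart_source _ _

theorem coordMap_mem_target {f : X → Y} {x₀ : X} {z : Fin n → ℂ}
    (hz : z ∈ coordDomain (n := n) m f x₀) :
    coordMap (n := n) (m := m) f x₀ z ∈ (chartAt (Fin m → ℂ) (f x₀)).target :=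
  (chartAt (Fin m → ℂ) (f x₀)).map_source hz.2

theorem chartAt_symm_coordMap {f : X → Y} {x₀ : X} {z : Fin n → ℂ}
    (hz : z ∈ coordDomain (n := n) m f x₀) :
    (chartAt (Fin m → ℂ) (f x₀)).symm (coordMap f x₀ z) =
      f ((chartAt (Fin n → ℂ) x₀).symm z) :=
  (chartAt (Fin m → ℂ) (f x₀)).left_inv hz.2

variable [IsManifold 𝓘(ℂ, Fin n → ℂ) 1 X] [IsManifold 𝓘(ℂ, Fin m → ℂ) 1 Y]

theorem differentiableAt_coordMap {f : X → Y}
    (hf : MDifferentiable 𝓘(ℂ, Fin n → ℂ) 𝓘(ℂ, Fin m → ℂ) f) {x₀ : X} {z : Fin n → ℂ}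
    (hz : z ∈ coordDomain (n := n) m f x₀) :
    DifferentiableAt ℂ (coordMap (n := n) (m := m) f x₀) z := by
  rw [← mdifferentiableAt_iff_differentiableAt]
  have h1 := (mdifferentiable_chart (I := 𝓘(ℂ, Fin n → ℂ)) x₀).mdifferentiableAt_symm hz.1
  have h2 := (mdifferentiable_chart (I := 𝓘(ℂ, Fin m → ℂ)) (f x₀)).mdifferentiableAt hz.2
  exact h2.comp z ((hf _).comp z h1)

theorem differentialAt_chartSymmDeriv {f : X → Y}
    (hf : MDifferentiable 𝓘(ℂ, Fin n → ℂ) 𝓘(ℂ, Fin m → ℂ) f) {x₀ : X} {z : Fin n → ℂ}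
    (hz : z ∈ coordDomain (n := n) m f x₀) (v : Fin n → ℂ) :
    differentialAt (m := m) f ((chartAt (Fin n → ℂ) x₀).symm z) (chartSymmDeriv x₀ z v) =
      chartSymmDeriv (f x₀) (coordMap (n := n) (m := m) f x₀ z)
        (fderiv ℂ (coordMap (n := n) (m := m) f x₀) z v) := by
  have h1 := (mdifferentiable_chart (I := 𝓘(ℂ, Fin n → ℂ)) x₀).mdifferentiableAt_symm hz.1
  have h2 := (mdifferentiable_chart (I := 𝓘(ℂ, Fin m → ℂ)) (f x₀)).mdifferentiableAt_symm
    (coordMap_mem_target hz)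
  have h3 := mdifferentiableAt_iff_differentiableAt.2 (differentiableAt_coordMap hf hz)
  have e1 := mfderiv_comp z (hf _) h1
  have e2 := mfderiv_comp z h2 h3
  have e3 : (f ∘ (chartAt (Fin n → ℂ) x₀).symm) =ᶠ[𝓝 z]
      ((chartAt (Fin m → ℂ) (f x₀)).symm ∘ coordMap f x₀) := by
    filter_upwards [(isOpen_coordDomain hf.continuous x₀).mem_nhds hz] with w hw
    exact (chartAt_symm_coordMap hw).symm
  have e4 : (mfderiv 𝓘(ℂ, Fin n → ℂ) 𝓘(ℂ, Fin m → ℂ) (f ∘ (chartAt (Fin n → ℂ) x₀).symm) z :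
      (Fin n → ℂ) →L[ℂ] (Fin m → ℂ)) =
      (mfderiv 𝓘(ℂ, Fin n → ℂ) 𝓘(ℂ, Fin m → ℂ)
        ((chartAt (Fin m → ℂ) (f x₀)).symm ∘ coordMap f x₀) z :) := e3.mfderiv_eq
  have e5 : (mfderiv 𝓘(ℂ, Fin n → ℂ) 𝓘(ℂ, Fin m → ℂ) (f ∘ (chartAt (Fin n → ℂ) x₀).symm) z :
      (Fin n → ℂ) →L[ℂ] (Fin m → ℂ)) =
      (differentialAt (m := m) f ((chartAt (Fin n → ℂ) x₀).symm z)).comp (chartSymmDeriv x₀ z) := e1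
  have e6 : (mfderiv 𝓘(ℂ, Fin n → ℂ) 𝓘(ℂ, Fin m → ℂ)
        ((chartAt (Fin m → ℂ) (f x₀)).symm ∘ coordMap f x₀) z :
        (Fin n → ℂ) →L[ℂ] (Fin m → ℂ)) = (chartSymmDeriv (f x₀) (coordMap (n := n) (m := m) f x₀ z)).comp
        (fderiv ℂ (coordMap (n := n) (m := m) f x₀) z) := by
    rw [← mfderiv_eq_fderiv]
    exact e2
  rw [e5, e6] at e4
  exact DFunLike.congr_fun e4 v

/-- The transposed Jacobian matrix `∂_i f^α` of the coordinate representative. -/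
noncomputable def jacobian (m : ℕ) [ChartedSpace (Fin m → ℂ) Y] (f : X → Y) (x₀ : X)
    (z : Fin n → ℂ) : Matrix (Fin n) (Fin m) ℂ :=
  Matrix.of fun i a => fderiv ℂ (coordMap (n := n) (m := m) f x₀) z (Pi.single i 1) a

theorem formAt_differentialAt {f : X → Y}
    (hf : MDifferentiable 𝓘(ℂ, Fin n → ℂ) 𝓘(ℂ, Fin m → ℂ) f) (h : HermitianMetric m Y)
    {x₀ : X} {z : Fin n → ℂ} (hz : z ∈ coordDomain (n := n) m f x₀) (i j : Fin n) :
    h.formAt (f ((chartAt (Fin n → ℂ) x₀).symm z))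
      (differentialAt (m := m) f ((chartAt (Fin n → ℂ) x₀).symm z)
        (chartSymmDeriv x₀ z (Pi.single i 1)))
      (differentialAt (m := m) f ((chartAt (Fin n → ℂ) x₀).symm z)
        (chartSymmDeriv x₀ z (Pi.single j 1))) =
      (jacobian m f x₀ z * (h.coeff (f x₀) (coordMap f x₀ z) * (jacobian m f x₀ z)ᴴ)) i j := by
  rw [differentialAt_chartSymmDeriv hf hz, differentialAt_chartSymmDeriv hf hz,
    ← chartAt_symm_coordMap hz, h.formAt_chartSymmDeriv]
  simp only [Matrix.mul_apply, Finset.mul_sum, Matrix.conjTranspose_apply, jacobian,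
    Matrix.of_apply]
  refine Finset.sum_congr rfl fun k _ => Finset.sum_congr rfl fun l _ => ?_
  rw [starRingEnd_apply]
  ring

/-- Independence of the trace from the frame; used with B = A*. -/
theorem trace_inv_mul_congr {ι : Type*} [Fintype ι] [DecidableEq ι] (A B G P : Matrix ι ι ℂ)
    (hA : IsUnit A.det) (hB : IsUnit B.det) :
    ((A * G * B)⁻¹ * (A * P * B)).trace = (G⁻¹ * P).trace := by
  rw [Matrix.mul_inv_rev, Matrix.mul_inv_rev]
  have h1 : B⁻¹ * (G⁻¹ * A⁻¹) * (A * P * B) = B⁻¹ * (G⁻¹ * P * B) := by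
    simp only [Matrix.mul_assoc]
    rw [← Matrix.mul_assoc A⁻¹ A, Matrix.nonsing_inv_mul _ hA, Matrix.one_mul]
  rw [h1, Matrix.trace_mul_comm, Matrix.mul_assoc, Matrix.mul_nonsing_inv _ hB, Matrix.mul_one]

/-- The energy density in the charts at `x₀` and `f x₀`. -/
theorem energyDensity_chartAt_symm (g : HermitianMetric n X) (h : HermitianMetric m Y) {f : X → Y}
    (hf : MDifferentiable 𝓘(ℂ, Fin n → ℂ) 𝓘(ℂ, Fin m → ℂ) f) {x₀ : X} {z : Fin n → ℂ}
    (hz : z ∈ coordDomain (n := n) m f x₀) :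
    energyDensity g h f ((chartAt (Fin n → ℂ) x₀).symm z) =
      ((g.coeff x₀ z)⁻¹ * (jacobian m f x₀ z *
        (h.coeff (f x₀) (coordMap f x₀ z) * (jacobian m f x₀ z)ᴴ))).trace.re := by
  set x := (chartAt (Fin n → ℂ) x₀).symm z with hx
  -- `energyDensity` uses a different chart at each point, while differentiation needs one fixed
  -- chart. A is the change of frame between them at x.
  set A : Matrix (Fin n) (Fin n) ℂ :=
    Matrix.of fun k p => chartSymmDeriv x₀ z (Pi.single k 1) p with hAdef
  have hAe : ∀ k, chartSymmDeriv x₀ z (Pi.single k 1) =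
      ∑ p, A k p • (Pi.single p 1 : Fin n → ℂ) := fun k => (sum_smul_single _).symm
  set P : Matrix (Fin n) (Fin n) ℂ := Matrix.of fun i j => h.formAt (f x)
    (differentialAt (m := m) f x (Pi.single i 1)) (differentialAt (m := m) f x (Pi.single j 1))
  have e1 : energyDensity g h f x =
      ((g.coeff x (chartAt (Fin n → ℂ) x x))⁻¹ * P).trace.re := by
    simp only [energyDensity, HermitianMetric.invCoeff, Matrix.trace, Matrix.diag, Matrix.mul_apply,
      Matrix.transpose_apply]
    rw [Finset.sum_comm]
    rfl
  have e2 : g.coeff x₀ z = A * g.coeff x (chartAt (Fin n → ℂ) x x) * Aᴴ := by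
    ext k l
    rw [g.coeff_apply, hAe k, hAe l, sesqForm_expand, Matrix.mul_assoc]
    simp only [Matrix.mul_apply, Finset.mul_sum, Matrix.conjTranspose_apply, g.coeff_self]
    refine Finset.sum_congr rfl fun p _ => Finset.sum_congr rfl fun q _ => ?_
    rw [starRingEnd_apply]
    ring
  have e3 : jacobian m f x₀ z * (h.coeff (f x₀) (coordMap f x₀ z) * (jacobian m f x₀ z)ᴴ) =
      A * P * Aᴴ := by
    ext k l
    rw [← formAt_differentialAt hf h hz, hAe k, hAe l]
    simp only [map_sum (differentialAt (m := m) f _), map_smul (differentialAt (m := m) f _)]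
    rw [sesqForm_expand, Matrix.mul_assoc]
    simp only [Matrix.mul_apply, Finset.mul_sum, Matrix.conjTranspose_apply]
    refine Finset.sum_congr rfl fun p _ => Finset.sum_congr rfl fun q _ => ?_
    rw [starRingEnd_apply, mul_right_comm, mul_comm (A k p)]
    rfl
  have hdet := g.isUnit_det_coeff hz.1
  rw [e2, Matrix.det_mul, Matrix.det_mul, IsUnit.mul_iff, IsUnit.mul_iff] at hdet
  rw [e1, e2, e3, trace_inv_mul_congr _ _ _ _ hdet.1.1 hdet.2]

/-- The differentials of the charts intertwine the coordinate derivative F with ∂f. The target one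
is injective, so F has the rank of a composite ending in a restriction of ∂f. -/
theorem rank_jacobian_le {f : X → Y} (hf : MDifferentiable 𝓘(ℂ, Fin n → ℂ) 𝓘(ℂ, Fin m → ℂ) f)
    {r : ℕ} (hr : HasRank (n := n) (m := m) f r) {x₀ : X} {z : Fin n → ℂ}
    (hz : z ∈ coordDomain (n := n) m f x₀) : (jacobian m f x₀ z).rank ≤ r := by
  set F := fderiv ℂ (coordMap (n := n) (m := m) f x₀) z
  set D := differentialAt (n := n) (m := m) f ((chartAt (Fin n → ℂ) x₀).symm z)
  set B := chartSymmDeriv (f x₀) (coordMap (n := n) (m := m) f x₀ z)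
  have h1 : (jacobian m f x₀ z)ᵀ = LinearMap.toMatrix' (F : (Fin n → ℂ) →ₗ[ℂ] (Fin m → ℂ)) := by
    ext a i
    simp [jacobian, LinearMap.toMatrix'_apply, F]
  have h2 : (D : (Fin n → ℂ) →ₗ[ℂ] (Fin m → ℂ)) ∘ₗ
      (chartSymmDeriv x₀ z : (Fin n → ℂ) →ₗ[ℂ] (Fin n → ℂ)) =
      (B : (Fin m → ℂ) →ₗ[ℂ] (Fin m → ℂ)) ∘ₗ
        (F : (Fin n → ℂ) →ₗ[ℂ] (Fin m → ℂ)) :=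
    LinearMap.ext fun v => differentialAt_chartSymmDeriv hf hz v
  have h3 : Module.finrank ℂ (LinearMap.range (D : (Fin n → ℂ) →ₗ[ℂ] (Fin m → ℂ))) ≤ r :=
    hr.2 ⟨_, rfl⟩
  rw [← Matrix.rank_transpose, h1, Matrix.rank, ← Matrix.toLin'_apply', Matrix.toLin'_toMatrix']
  have h4 : Module.finrank ℂ (LinearMap.range (F : (Fin n → ℂ) →ₗ[ℂ] (Fin m → ℂ))) =
      Module.finrank ℂ (LinearMap.range
        ((B : (Fin m → ℂ) →ₗ[ℂ] (Fin m → ℂ)) ∘ₗ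
          (F : (Fin n → ℂ) →ₗ[ℂ] (Fin m → ℂ)))) := by
    rw [LinearMap.range_comp]
    exact (Submodule.equivMapOfInjective (B : (Fin m → ℂ) →ₗ[ℂ] (Fin m → ℂ))
      (chartSymmDeriv_injective (coordMap_mem_target hz)) _).finrank_eq
  rw [h4, ← h2]
  exact (Submodule.finrank_mono (LinearMap.range_comp_le_range _ _)).trans h3

end Charts

/-! ### Norms of torsion tensors and curvature contractions -/

section Tensors

theorem sum_reorder {α β γ δ ρ σ : Type*} [Fintype α] [Fintype β] [Fintype γ] [Fintype δ]
    [Fintype ρ] [Fintype σ] (f : α → β → γ → δ → ρ → σ → ℂ) :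
    ∑ a, ∑ b, ∑ c, ∑ d, ∑ r, ∑ s, f a b c d r s =
      ∑ b, ∑ d, ∑ s, ∑ a, ∑ c, ∑ r, f a b c d r s := by
  rw [Finset.sum_comm]
  refine Finset.sum_congr rfl fun b _ => ?_
  calc ∑ a, ∑ c, ∑ d, ∑ r, ∑ s, f a b c d r s
      = ∑ a, ∑ d, ∑ c, ∑ s, ∑ r, f a b c d r s := Finset.sum_congr rfl fun a _ => by
        rw [Finset.sum_comm]
        exact Finset.sum_congr rfl fun d _ => Finset.sum_congr rfl fun c _ => Finset.sum_comm
    _ = ∑ d, ∑ a, ∑ s, ∑ c, ∑ r, f a b c d r s := by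
        rw [Finset.sum_comm]
        exact Finset.sum_congr rfl fun d _ => Finset.sum_congr rfl fun a _ => Finset.sum_comm
    _ = _ := Finset.sum_congr rfl fun d _ => Finset.sum_comm

theorem sum_comm_pairs {α β γ δ : Type*} [Fintype α] [Fintype β] [Fintype γ] [Fintype δ]
    (f : α → β → γ → δ → ℂ) :
    ∑ a, ∑ b, ∑ c, ∑ d, f a b c d = ∑ c, ∑ d, ∑ a, ∑ b, f a b c d := by
  calc ∑ a, ∑ b, ∑ c, ∑ d, f a b c d = ∑ a, ∑ c, ∑ d, ∑ b, f a b c d :=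
        Finset.sum_congr rfl fun a _ => by
          rw [Finset.sum_comm]
          exact Finset.sum_congr rfl fun c _ => Finset.sum_comm
    _ = _ := by
        rw [Finset.sum_comm]
        exact Finset.sum_congr rfl fun c _ => Finset.sum_comm

variable {ι κ : Type*} [Fintype ι] [Fintype κ]

theorem quadForm_comp_equiv (M : Matrix ι ι ℂ) (e : ι ≃ ι) (hM : ∀ p q, M (e p) (e q) = M p q)
    (x : ι → ℂ) : quadForm M (x ∘ e) = quadForm M x := by
  rw [quadForm_eq_sum, quadForm_eq_sum,
    ← Equiv.sum_comp e fun p => ∑ q, (starRingEnd ℂ) (x p) * (M p q * x q)]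
  congr 1
  refine Finset.sum_congr rfl fun p _ => ?_
  rw [← Equiv.sum_comp e fun q => (starRingEnd ℂ) (x (e p)) * (M (e p) q * x q)]
  exact Finset.sum_congr rfl fun q _ => by rw [hM]; rfl

/-- The metric on tensors with two covariant indices and values in a Hermitian space. -/
def tensorMetric (g : Matrix ι ι ℂ) (H : Matrix κ κ ℂ) : Matrix (ι × ι × κ) (ι × ι × κ) ℂ :=
  g ⊗ₖ (g ⊗ₖ Hᵀ)

theorem posSemidef_tensorMetric {g : Matrix ι ι ℂ} {H : Matrix κ κ ℂ} (hg : g.PosSemidef)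
    (hH : H.PosSemidef) : (tensorMetric g H).PosSemidef :=
  hg.kronecker (hg.kronecker hH.transpose)

/-- A three index array as a vector. -/
def tensorVec (T : ι → ι → κ → ℂ) (p : ι × ι × κ) : ℂ := T p.1 p.2.1 p.2.2

/-- The norm of a tensor controls that of its antisymmetric part. -/
theorem quadForm_antisymm_le {g : Matrix ι ι ℂ} {H : Matrix κ κ ℂ} (hg : g.PosSemidef)
    (hH : H.PosSemidef) (S : ι → ι → κ → ℂ) :
    (1 / 4) * quadForm (tensorMetric g H) (tensorVec fun i k a => S i k a - S k i a) ≤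
      quadForm (tensorMetric g H) (tensorVec S) := by
  -- Swapping the two covariant slots is an isometry, as both carry the metric g; thus |S − S∘e|² ≤
  -- 2|S|² + 2|S∘e|² = 4|S|².
  let e : ι × ι × κ ≃ ι × ι × κ :=
    { toFun := fun p => (p.2.1, p.1, p.2.2)
      invFun := fun p => (p.2.1, p.1, p.2.2)
      left_inv := fun _ => rfl
      right_inv := fun _ => rfl }
  have h1 : quadForm (tensorMetric g H) (tensorVec S ∘ e) =
      quadForm (tensorMetric g H) (tensorVec S) := by
    refine quadForm_comp_equiv _ e (fun p q => ?_) _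
    simp only [tensorMetric, Matrix.kroneckerMap_apply, e, Equiv.coe_fn_mk]
    ring
  have h2 := quadForm_sub_le (posSemidef_tensorMetric hg hH) (tensorVec S) (tensorVec S ∘ e)
  rw [h1] at h2
  have h3 : (tensorVec fun i k a => S i k a - S k i a) = tensorVec S - tensorVec S ∘ e := rfl
  rw [h3]
  linarith

/-- `quadForm` conjugates its first index. This fits g, an inverse metric matrix whose indices are
already exchanged, and explains the transpose of H in `tensorMetric`. -/
theorem quadForm_tensorVec (g : Matrix ι ι ℂ) (H : Matrix κ κ ℂ) (T : ι → ι → κ → ℂ) :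
    quadForm (tensorMetric g H) (tensorVec T) = (∑ α, ∑ β, ∑ γ, ∑ δ, ∑ ρ, ∑ σ,
      g β α * g δ γ * H ρ σ * T α γ ρ * (starRingEnd ℂ) (T β δ σ)).re := by
  rw [sum_reorder, quadForm_eq_sum]
  simp only [Fintype.sum_prod_type, tensorMetric, tensorVec, Matrix.kroneckerMap_apply,
    Matrix.transpose_apply]
  congr 1
  refine Finset.sum_congr rfl fun _ _ => Finset.sum_congr rfl fun _ _ =>
    Finset.sum_congr rfl fun _ _ => Finset.sum_congr rfl fun _ _ =>
    Finset.sum_congr rfl fun _ _ => Finset.sum_congr rfl fun _ _ => by ring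

theorem trace_mul_eq_sum (g : Matrix ι ι ℂ) (H : Matrix κ κ ℂ) (S S' : Matrix ι κ ℂ) :
    (g * S * H * S'ᴴ).trace = ∑ k, ∑ l, ∑ a, ∑ b,
      g l k * H a b * S k a * (starRingEnd ℂ) (S' l b) := by
  have h : (g * S * H * S'ᴴ).trace = ∑ l, ∑ b, ∑ a, ∑ k,
      g l k * H a b * S k a * (starRingEnd ℂ) (S' l b) := by
    simp only [Matrix.trace, Matrix.diag, Matrix.mul_apply, Matrix.conjTranspose_apply,
      Finset.sum_mul]
    refine Finset.sum_congr rfl fun _ _ => Finset.sum_congr rfl fun _ _ =>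
      Finset.sum_congr rfl fun _ _ => Finset.sum_congr rfl fun _ _ => ?_
    rw [starRingEnd_apply]
    ring
  rw [h, Finset.sum_comm (s := Finset.univ (α := ι)) (t := Finset.univ (α := ι))]
  refine Finset.sum_congr rfl fun l _ => ?_
  rw [Finset.sum_comm]
  calc _ = ∑ a, ∑ k, ∑ b, g l k * H a b * S k a * (starRingEnd ℂ) (S' l b) :=
        Finset.sum_congr rfl fun a _ => Finset.sum_comm
    _ = _ := Finset.sum_comm

theorem re_sum_trace_eq_quadForm (g : Matrix ι ι ℂ) (H : Matrix κ κ ℂ) (S : ι → Matrix ι κ ℂ) :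
    (∑ i, ∑ j, g j i * (g * S i * H * (S j)ᴴ).trace).re =
      quadForm (tensorMetric g H) (tensorVec fun i k a => S i k a) := by
  rw [quadForm_tensorVec]
  simp only [trace_mul_eq_sum, Finset.mul_sum]
  refine congrArg Complex.re ?_
  iterate 6 refine Finset.sum_congr rfl fun _ _ => ?_
  ring

/-- K acts on both covariant slots and is absorbed into the metric. The resulting K*gK is the tensor
Ξ at which the bisectional curvature is tested. -/
theorem quadForm_pullback [DecidableEq κ] (g : Matrix ι ι ℂ) (H : Matrix κ κ ℂ)
    (K : Matrix ι κ ℂ) (T : κ → κ → κ → ℂ) :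
    quadForm (tensorMetric g H) (tensorVec fun i k a => ∑ β, ∑ γ, K i β * K k γ * T β γ a) =
      quadForm (tensorMetric (Kᴴ * g * K) H) (tensorVec T) := by
  have h : (tensorVec fun i k a => ∑ β, ∑ γ, K i β * K k γ * T β γ a) =
      (K ⊗ₖ (K ⊗ₖ (1 : Matrix κ κ ℂ))) *ᵥ tensorVec T := by
    ext ⟨i, k, a⟩
    simp [tensorVec, Matrix.mulVec, dotProduct, Fintype.sum_prod_type, Matrix.one_apply, mul_assoc]
  rw [h, quadForm_mulVec]
  simp only [tensorMetric, Matrix.conjTranspose_kronecker, ← Matrix.mul_kronecker_mul,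
    Matrix.conjTranspose_one, Matrix.one_mul, Matrix.mul_one]

/-- Here K acts on the value slot, so the metric there becomes KHK*, the pulled back metric. -/
theorem quadForm_pushforward [DecidableEq ι] (g : Matrix ι ι ℂ) (H : Matrix κ κ ℂ)
    (K : Matrix ι κ ℂ) (T : ι → ι → ι → ℂ) :
    quadForm (tensorMetric g H) (tensorVec fun i k a => ∑ p, T i k p * K p a) =
      quadForm (tensorMetric g (K * H * Kᴴ)) (tensorVec T) := by
  have h : (tensorVec fun i k a => ∑ p, T i k p * K p a) =
      ((1 : Matrix ι ι ℂ) ⊗ₖ ((1 : Matrix ι ι ℂ) ⊗ₖ Kᵀ)) *ᵥ tensorVec T := by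
    ext ⟨i, k, a⟩
    simp [tensorVec, Matrix.mulVec, dotProduct, Fintype.sum_prod_type, Matrix.one_apply, mul_comm]
  rw [h, quadForm_mulVec]
  simp only [tensorMetric, Matrix.conjTranspose_kronecker, ← Matrix.mul_kronecker_mul,
    Matrix.conjTranspose_one, Matrix.one_mul, Matrix.mul_one, Matrix.transpose_mul]
  rw [Matrix.mul_assoc]
  rfl

/-- The index matrix of Q° is a combination of rank one matrices (column j of G) · (row i of G), and
each pairs with W to give the (i, j) entry of GWG. -/
theorem trace_quadratic_torsion (g G W : Matrix ι ι ℂ) (T : ι → ι → ι → ℂ) :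
    ((Matrix.of fun k l => ∑ p, ∑ q, ∑ r, ∑ s, ∑ i, ∑ j,
      g q p * g s r * T p r i * (starRingEnd ℂ) (T q s j) * G k j * G i l) * W).trace.re =
      quadForm (tensorMetric g (G * W * G)) (tensorVec T) := by
  have h : (Matrix.of fun k l => ∑ p, ∑ q, ∑ r, ∑ s, ∑ i, ∑ j,
      g q p * g s r * T p r i * (starRingEnd ℂ) (T q s j) * G k j * G i l) =
      ∑ p, ∑ q, ∑ r, ∑ s, ∑ i, ∑ j, (g q p * g s r * T p r i * (starRingEnd ℂ) (T q s j)) •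
        vecMulVec (G.col j) (G.row i) := by
    ext k l
    simp only [Matrix.sum_apply, Matrix.smul_apply, Matrix.vecMulVec_apply, Matrix.of_apply,
      smul_eq_mul, Matrix.col_apply, Matrix.row_apply, mul_assoc]
  have h2 : ∀ i j, (vecMulVec (G.col j) (G.row i) * W).trace = (G * W * G) i j := by
    intro i j
    rw [Matrix.trace_mul_comm, Matrix.mul_vecMulVec, Matrix.trace_vecMulVec, Matrix.mul_assoc]
    simp only [dotProduct, Matrix.mulVec, Matrix.mul_apply, Matrix.col_apply, Matrix.row_apply]
    exact Finset.sum_congr rfl fun _ _ => mul_comm _ _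
  rw [h, quadForm_tensorVec]
  simp only [Matrix.sum_mul, Matrix.smul_mul, Matrix.trace_sum, Matrix.trace_smul, h2, smul_eq_mul]
  refine congrArg Complex.re ?_
  iterate 6 refine Finset.sum_congr rfl fun _ _ => ?_
  ring

theorem sum_trace_curvature (g P : Matrix ι ι ℂ) (R : ι → ι → Matrix ι ι ℂ) :
    ∑ i, ∑ j, g j i * (g * R i j * g * P).trace =
      ((∑ i, ∑ j, g j i • R i j) * (g * P * g)).trace := by
  simp only [Matrix.sum_mul, Matrix.smul_mul, Matrix.trace_sum, Matrix.trace_smul, smul_eq_mul]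
  refine Finset.sum_congr rfl fun i _ => Finset.sum_congr rfl fun j _ => ?_
  rw [Matrix.mul_assoc, Matrix.mul_assoc, Matrix.trace_mul_comm, Matrix.mul_assoc]

/-- The sum over the outer indices i, j and the inner trace each produce one factor Ξᵀ; this is the
quadratic expression of the real bisectional curvature. -/
theorem sum_trace_pullback_curvature (g : Matrix ι ι ℂ) (K : Matrix ι κ ℂ)
    (R : κ → κ → Matrix κ κ ℂ) :
    ∑ i, ∑ j, g j i * (g * K * (∑ α, ∑ β, (K i α * (starRingEnd ℂ) (K j β)) • R α β) * Kᴴ).trace =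
      ∑ α, ∑ β, ∑ γ, ∑ δ, R α β γ δ * (Kᴴ * g * K)ᵀ α β * (Kᴴ * g * K)ᵀ γ δ := by
  have h1 : ∀ A : Matrix κ κ ℂ, (g * K * A * Kᴴ).trace =
      ∑ γ, ∑ δ, A γ δ * (Kᴴ * g * K)ᵀ γ δ := by
    intro A
    rw [Matrix.mul_assoc (g * K), Matrix.trace_mul_comm, Matrix.mul_assoc, ← Matrix.mul_assoc Kᴴ]
    rfl
  have h2 : ∀ α β, (Kᴴ * g * K)ᵀ α β = ∑ i, ∑ j, g j i * (K i α * (starRingEnd ℂ) (K j β)) := by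
    intro α β
    simp only [Matrix.transpose_apply, Matrix.mul_apply, Matrix.conjTranspose_apply, Finset.sum_mul]
    refine Finset.sum_congr rfl fun _ _ => Finset.sum_congr rfl fun _ _ => ?_
    rw [starRingEnd_apply]
    ring
  have h3 : ∀ i j, (g * K * (∑ α, ∑ β, (K i α * (starRingEnd ℂ) (K j β)) • R α β) * Kᴴ).trace =
      ∑ α, ∑ β, (K i α * (starRingEnd ℂ) (K j β)) * (g * K * R α β * Kᴴ).trace := by
    intro i j
    simp only [Matrix.mul_sum, Matrix.sum_mul, Matrix.trace_sum, Matrix.mul_smul, Matrix.smul_mul,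
      Matrix.trace_smul, smul_eq_mul]
  have h4 : ∀ α β, ∑ γ, ∑ δ, R α β γ δ * (Kᴴ * g * K)ᵀ α β * (Kᴴ * g * K)ᵀ γ δ =
      (Kᴴ * g * K)ᵀ α β * (g * K * R α β * Kᴴ).trace := by
    intro α β
    rw [h1, Finset.mul_sum]
    refine Finset.sum_congr rfl fun _ _ => ?_
    rw [Finset.mul_sum]
    exact Finset.sum_congr rfl fun _ _ => by ring
  simp only [h3, h4]
  simp only [h2, Finset.mul_sum, Finset.sum_mul]
  rw [sum_comm_pairs]
  iterate 4 refine Finset.sum_congr rfl fun _ _ => ?_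
  ring

theorem sum_eq_trace_of_isHermitian (H Ξ : Matrix κ κ ℂ) (hΞ : Ξ.IsHermitian) :
    ∑ α, ∑ β, ∑ ν, ∑ μ, H α ν * H μ β * Ξᵀ α β * (starRingEnd ℂ) (Ξᵀ ν μ) =
      (H * Ξ * (H * Ξ)).trace := by
  have h1 : ∀ ν μ, (starRingEnd ℂ) (Ξ μ ν) = Ξ ν μ := fun ν μ => hΞ.apply ν μ
  have h2 : (H * Ξ * (H * Ξ)).trace =
      ∑ α, ∑ μ, (∑ ν, H α ν * Ξ ν μ) * ∑ β, H μ β * Ξ β α := by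
    simp only [Matrix.trace, Matrix.diag, Matrix.mul_apply]
  simp only [h1, h2, Finset.sum_mul_sum, Matrix.transpose_apply]
  refine Finset.sum_congr rfl fun α _ => ?_
  rw [Finset.sum_comm]
  calc _ = ∑ ν, ∑ μ, ∑ β, H α ν * H μ β * Ξ β α * Ξ ν μ :=
        Finset.sum_congr rfl fun ν _ => Finset.sum_comm
    _ = ∑ μ, ∑ ν, ∑ β, H α ν * H μ β * Ξ β α * Ξ ν μ := Finset.sum_comm
    _ = _ := by
        iterate 3 refine Finset.sum_congr rfl fun _ _ => ?_
        ring

/-- With H = B*B the trace is the squared Frobenius norm of BΞB*, and B is invertible. It allows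
clearing the denominator |ξ|². -/
theorem trace_mul_mul_self_pos [DecidableEq κ] {H Ξ : Matrix κ κ ℂ} (hH : H.PosDef)
    (hΞ : Ξ.IsHermitian) (h0 : Ξ ≠ 0) : 0 < (H * Ξ * (H * Ξ)).trace.re := by
  obtain ⟨B, rfl⟩ := exists_eq_conjTranspose_mul_self hH.posSemidef
  have hB : IsUnit B.det := by
    have := (Matrix.isUnit_iff_isUnit_det _).1 hH.isUnit
    rw [Matrix.det_mul] at this
    exact (IsUnit.mul_iff.1 this).2
  set Q := B * Ξ * Bᴴ with hQ
  have hQh : Qᴴ = Q := Matrix.isHermitian_mul_mul_conjTranspose B hΞ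
  have h1 : (Bᴴ * B * Ξ * (Bᴴ * B * Ξ)).trace = (Qᴴ * Q).trace := by
    rw [hQh, hQ]
    simp only [Matrix.mul_assoc]
    rw [Matrix.trace_mul_comm]
    simp only [Matrix.mul_assoc]
  rw [h1]
  have h2 : 0 ≤ (Qᴴ * Q).trace := (Matrix.posSemidef_conjTranspose_mul_self Q).trace_nonneg
  have h3 : (Qᴴ * Q).trace ≠ 0 := by
    rw [Ne, Matrix.trace_conjTranspose_mul_self_eq_zero_iff]
    intro hQ0
    apply h0
    have hBh : IsUnit (Bᴴ).det := by rw [Matrix.det_conjTranspose]; exact hB.star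
    have h4 : B⁻¹ * Q * (Bᴴ)⁻¹ = Ξ := by
      rw [hQ, ← Matrix.mul_assoc, ← Matrix.mul_assoc, Matrix.nonsing_inv_mul _ hB, Matrix.one_mul,
        Matrix.mul_assoc, Matrix.mul_nonsing_inv _ hBh, Matrix.mul_one]
    rw [← h4, hQ0, Matrix.mul_zero, Matrix.zero_mul]
  exact (Complex.lt_def.1 (lt_of_le_of_ne h2 h3.symm)).1

end Tensors

/-! ### Wirtinger derivatives and conjugate transposes -/

section MatrixWirtinger

variable {n : ℕ} {ι κ : Type*} {U : Set (Fin n → ℂ)} {z : Fin n → ℂ}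

theorem twistedDeriv_eventuallyEq {ε : ℂ} {i : Fin n} {φ ψ : (Fin n → ℂ) → ℂ}
    (h : φ =ᶠ[𝓝 z] ψ) : twistedDeriv ε i φ =ᶠ[𝓝 z] twistedDeriv ε i ψ :=
  h.eventuallyEq_nhds.mono fun _ hw => twistedDeriv_congr hw

theorem matrixDeriv_conjTranspose (j : Fin n) (M : (Fin n → ℂ) → Matrix ι κ ℂ) (z : Fin n → ℂ) :
    matrixDeriv Complex.I j (fun w => (M w)ᴴ) z = (matrixDeriv (-Complex.I) j M z)ᴴ := by
  ext a b
  have h := wirtingerBar_conj (i := j) (φ := fun w => M w b a) (z := z)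
  rw [wirtingerBar_eq_twistedDeriv, wirtinger_eq_twistedDeriv] at h
  exact h

theorem matrixDeriv_neg_I_conjTranspose (i : Fin n) (M : (Fin n → ℂ) → Matrix ι κ ℂ)
    (z : Fin n → ℂ) :
    matrixDeriv (-Complex.I) i (fun w => (M w)ᴴ) z = (matrixDeriv Complex.I i M z)ᴴ := by
  ext a b
  have h := wirtinger_conj (i := i) (φ := fun w => M w b a) (z := z)
  rw [wirtingerBar_eq_twistedDeriv, wirtinger_eq_twistedDeriv] at h
  exact h

theorem matrixDeriv_I_of_isHermitian (hU : IsOpen U) (hz : z ∈ U) {M : (Fin n → ℂ) → Matrix ι ι ℂ}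
    (hM : ∀ w ∈ U, (M w).IsHermitian) (j : Fin n) :
    matrixDeriv Complex.I j M z = (matrixDeriv (-Complex.I) j M z)ᴴ := by
  rw [← matrixDeriv_conjTranspose]
  exact matrixDeriv_congr hU hz fun w hw => (hM w hw).eq.symm

theorem MatrixSmoothOn.conjTranspose {M : (Fin n → ℂ) → Matrix ι κ ℂ} (hM : MatrixSmoothOn M U) :
    MatrixSmoothOn (fun w => (M w)ᴴ) U :=
  fun a b => Complex.conjCLE.contDiff.comp_contDiffOn (hM b a)

end MatrixWirtinger

/-! ### Derivatives of the Jacobian and of the metric along f -/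

section LocalBochner

variable {n m : ℕ} {X Y : Type*} [TopologicalSpace X] [ChartedSpace (Fin n → ℂ) X]
  [TopologicalSpace Y] [ChartedSpace (Fin m → ℂ) Y]
  [IsManifold 𝓘(ℂ, Fin n → ℂ) 1 X] [IsManifold 𝓘(ℂ, Fin m → ℂ) 1 Y]
  {f : X → Y} {x₀ : X} {z : Fin n → ℂ}

theorem contDiffOn_coordMap (hf : MDifferentiable 𝓘(ℂ, Fin n → ℂ) 𝓘(ℂ, Fin m → ℂ) f) :
    ContDiffOn ℂ ∞ (coordMap (n := n) (m := m) f x₀) (coordDomain (n := n) m f x₀) :=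
  DifferentiableOn.contDiffOn_complex (isOpen_coordDomain hf.continuous x₀) fun _ hw =>
    (differentiableAt_coordMap hf hw).differentiableWithinAt

theorem contDiffOn_jacobian (hf : MDifferentiable 𝓘(ℂ, Fin n → ℂ) 𝓘(ℂ, Fin m → ℂ) f)
    (i : Fin n) (a : Fin m) :
    ContDiffOn ℂ ∞ (fun w => jacobian m f x₀ w i a) (coordDomain (n := n) m f x₀) := by
  have h := ((contDiffOn_infty_iff_fderiv_of_isOpen (isOpen_coordDomain hf.continuous x₀)).1
    (contDiffOn_coordMap hf)).2
  have h2 : ContDiffOn ℂ ∞ (fun w => fderiv ℂ (coordMap (n := n) (m := m) f x₀) w (Pi.single i 1))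
      (coordDomain (n := n) m f x₀) := h.clm_apply contDiffOn_const
  exact (contDiffOn_pi.1 h2) a

theorem matrixSmoothOn_jacobian (hf : MDifferentiable 𝓘(ℂ, Fin n → ℂ) 𝓘(ℂ, Fin m → ℂ) f) :
    MatrixSmoothOn (jacobian m f x₀) (coordDomain (n := n) m f x₀) :=
  fun i a => (contDiffOn_jacobian hf i a).restrict_scalars ℝ

theorem differentiableAt_jacobian (hf : MDifferentiable 𝓘(ℂ, Fin n → ℂ) 𝓘(ℂ, Fin m → ℂ) f)
    (hz : z ∈ coordDomain (n := n) m f x₀) (i : Fin n) (a : Fin m) :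
    DifferentiableAt ℂ (fun w => jacobian m f x₀ w i a) z :=
  ((contDiffOn_jacobian hf i a).contDiffAt
    ((isOpen_coordDomain hf.continuous x₀).mem_nhds hz)).differentiableAt (by simp)

theorem matrixDeriv_I_jacobian (hf : MDifferentiable 𝓘(ℂ, Fin n → ℂ) 𝓘(ℂ, Fin m → ℂ) f)
    (hz : z ∈ coordDomain (n := n) m f x₀) (j : Fin n) :
    matrixDeriv Complex.I j (jacobian m f x₀) z = 0 := by
  ext i a
  exact wirtingerBar_of_differentiableAt (differentiableAt_jacobian hf hz i a)

/-- The derivatives commute, and ∂̄_j annihilates the Jacobian near z. -/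
theorem matrixDeriv_matrixDeriv_jacobian
    (hf : MDifferentiable 𝓘(ℂ, Fin n → ℂ) 𝓘(ℂ, Fin m → ℂ) f)
    (hz : z ∈ coordDomain (n := n) m f x₀) (i j : Fin n) :
    matrixDeriv Complex.I j (matrixDeriv (-Complex.I) i (jacobian m f x₀)) z = 0 := by
  have hU := isOpen_coordDomain (n := n) (m := m) hf.continuous x₀
  ext k a
  have h : ContDiffAt ℝ 2 (fun w => jacobian m f x₀ w k a) z :=
    ((matrixSmoothOn_jacobian hf k a).contDiffAt (hU.mem_nhds hz)).of_le (ENat.LEInfty.out)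
  have h1 : twistedDeriv Complex.I j (twistedDeriv (-Complex.I) i
      fun w => jacobian m f x₀ w k a) z = 0 := by
    rw [twistedDeriv_comm h, twistedDeriv_congr (ψ := fun _ => 0), twistedDeriv_const]
    filter_upwards [hU.mem_nhds hz] with w hw
    exact congrFun (congrFun (matrixDeriv_I_jacobian hf hw j) k) a
  exact h1

/-- Both sides are mixed second partials of a component of the coordinate map. -/
theorem matrixDeriv_jacobian_symm (hf : MDifferentiable 𝓘(ℂ, Fin n → ℂ) 𝓘(ℂ, Fin m → ℂ) f)
    (hz : z ∈ coordDomain (n := n) m f x₀) (i k : Fin n) (a : Fin m) :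
    matrixDeriv (-Complex.I) i (jacobian m f x₀) z k a =
      matrixDeriv (-Complex.I) k (jacobian m f x₀) z i a := by
  have hU := isOpen_coordDomain (n := n) (m := m) hf.continuous x₀
  have h1 : ∀ p, (fun w => jacobian m f x₀ w p a) =ᶠ[𝓝 z]
      twistedDeriv (-Complex.I) p fun w => coordMap (n := n) (m := m) f x₀ w a := by
    intro p
    filter_upwards [hU.mem_nhds hz] with w hw
    have hd := differentiableAt_coordMap hf hw
    have hda : DifferentiableAt ℂ (fun w => coordMap (n := n) (m := m) f x₀ w a) w :=
      differentiableAt_pi.1 hd a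
    rw [← wirtinger_eq_twistedDeriv, wirtinger_of_differentiableAt hda]
    exact congrArg (fun T => T (Pi.single p 1)) (fderiv_apply hd a).symm
  have h2 : ContDiffAt ℝ 2 (fun w => coordMap (n := n) (m := m) f x₀ w a) z := by
    have := contDiffOn_pi.1 ((contDiffOn_coordMap (x₀ := x₀) hf).restrict_scalars ℝ) a
    exact (this.contDiffAt (hU.mem_nhds hz)).of_le (ENat.LEInfty.out)
  simp only [matrixDeriv, Matrix.of_apply]
  rw [twistedDeriv_congr (h1 k), twistedDeriv_congr (h1 i), twistedDeriv_comm h2]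

variable (h : HermitianMetric m Y)

theorem matrixSmoothOn_coeff_coordMap
    (hf : MDifferentiable 𝓘(ℂ, Fin n → ℂ) 𝓘(ℂ, Fin m → ℂ) f) :
    MatrixSmoothOn (fun w => h.coeff (f x₀) (coordMap (n := n) (m := m) f x₀ w))
      (coordDomain (n := n) m f x₀) :=
  fun a b => (h.matrixSmoothOn_coeff (f x₀) a b).comp
    ((contDiffOn_coordMap hf).restrict_scalars ℝ) fun _ hw => coordMap_mem_target hw

theorem matrixDeriv_coeff_coordMap
    (hf : MDifferentiable 𝓘(ℂ, Fin n → ℂ) 𝓘(ℂ, Fin m → ℂ) f)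
    (hz : z ∈ coordDomain (n := n) m f x₀) (i : Fin n) :
    matrixDeriv (-Complex.I) i (fun w => h.coeff (f x₀) (coordMap (n := n) (m := m) f x₀ w)) z =
      ∑ α, jacobian m f x₀ z i α •
        matrixDeriv (-Complex.I) α (h.coeff (f x₀)) (coordMap f x₀ z) := by
  ext a b
  have h1 := wirtinger_comp (i := i) (differentiableAt_coordMap hf hz)
    ((h.matrixSmoothOn_coeff (f x₀)).differentiableAt
      (chartAt (Fin m → ℂ) (f x₀)).open_target (coordMap_mem_target hz) a b)
  simp only [wirtinger_eq_twistedDeriv] at h1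
  simp only [Matrix.sum_apply, Matrix.smul_apply, smul_eq_mul]
  exact h1

theorem matrixDeriv_matrixDeriv_coeff_coordMap
    (hf : MDifferentiable 𝓘(ℂ, Fin n → ℂ) 𝓘(ℂ, Fin m → ℂ) f)
    (hz : z ∈ coordDomain (n := n) m f x₀) (i j : Fin n) :
    matrixDeriv Complex.I j (matrixDeriv (-Complex.I) i
        (fun w => h.coeff (f x₀) (coordMap (n := n) (m := m) f x₀ w))) z =
      ∑ α, ∑ β, (jacobian m f x₀ z i α * (starRingEnd ℂ) (jacobian m f x₀ z j β)) •
        matrixDeriv Complex.I β (matrixDeriv (-Complex.I) α (h.coeff (f x₀)))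
          (coordMap f x₀ z) := by
  have hU := isOpen_coordDomain (n := n) (m := m) hf.continuous x₀
  rw [matrixDeriv_congr hU hz fun w hw => matrixDeriv_coeff_coordMap h hf hw i]
  ext a b
  have hV := (chartAt (Fin m → ℂ) (f x₀)).open_target
  have hK : ∀ α, DifferentiableAt ℝ (fun w => jacobian m f x₀ w i α) z := fun α =>
    (matrixSmoothOn_jacobian hf).differentiableAt hU hz i α
  have hH : ∀ α, DifferentiableAt ℝ
      (fun y => matrixDeriv (-Complex.I) α (h.coeff (f x₀)) y a b) (coordMap f x₀ z) := fun α =>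
    ((h.matrixSmoothOn_coeff (f x₀)).matrixDeriv hV).differentiableAt hV (coordMap_mem_target hz) a b
  have hF := differentiableAt_coordMap hf hz
  have hHF : ∀ α, DifferentiableAt ℝ
      (fun w => matrixDeriv (-Complex.I) α (h.coeff (f x₀)) (coordMap f x₀ w) a b) z := fun α =>
    (hH α).comp z (hF.restrictScalars ℝ)
  have h1 : ∀ α, twistedDeriv Complex.I j (fun w => jacobian m f x₀ w i α *
      matrixDeriv (-Complex.I) α (h.coeff (f x₀)) (coordMap f x₀ w) a b) z =
      ∑ β, (jacobian m f x₀ z i α * (starRingEnd ℂ) (jacobian m f x₀ z j β)) *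
        matrixDeriv Complex.I β (matrixDeriv (-Complex.I) α (h.coeff (f x₀)))
          (coordMap f x₀ z) a b := by
    intro α
    have h2 := wirtingerBar_comp (i := j) hF (hH α)
    simp only [wirtingerBar_eq_twistedDeriv] at h2
    have h3 : twistedDeriv Complex.I j (fun w => jacobian m f x₀ w i α) z = 0 :=
      congrFun (congrFun (matrixDeriv_I_jacobian hf hz j) i) α
    rw [twistedDeriv_mul (hK α) (hHF α), h3, h2, zero_mul, zero_add, Finset.mul_sum]
    refine Finset.sum_congr rfl fun β _ => ?_
    rw [← mul_assoc]
    rfl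
  simp only [Matrix.sum_apply, Matrix.smul_apply, smul_eq_mul, ← h1]
  have h4 : matrixDeriv Complex.I j (fun w => ∑ α, jacobian m f x₀ w i α •
      matrixDeriv (-Complex.I) α (h.coeff (f x₀)) (coordMap f x₀ w)) z a b =
      twistedDeriv Complex.I j (fun w => ∑ α, jacobian m f x₀ w i α *
        matrixDeriv (-Complex.I) α (h.coeff (f x₀)) (coordMap f x₀ w) a b) z := by
    simp only [matrixDeriv, Matrix.of_apply, Matrix.sum_apply, Matrix.smul_apply, smul_eq_mul]
  rw [h4, twistedDeriv_sum _ fun α _ => (hK α).fun_mul (hHF α)]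

end LocalBochner

/-! ### The Bochner formula before contraction -/

section Bochner

variable {n m : ℕ} {X Y : Type*} [TopologicalSpace X] [ChartedSpace (Fin n → ℂ) X]
  [TopologicalSpace Y] [ChartedSpace (Fin m → ℂ) Y]
  [IsManifold 𝓘(ℂ, Fin n → ℂ) 1 X] [IsManifold 𝓘(ℂ, Fin m → ℂ) 1 Y]
  {f : X → Y} {x₀ : X} {z : Fin n → ℂ} (g : HermitianMetric n X) (h : HermitianMetric m Y)

/-- The complex valued energy in the charts at `x₀` and `f x₀`. -/
noncomputable def coordEnergy (g : HermitianMetric n X) (h : HermitianMetric m Y) (f : X → Y)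
    (x₀ : X) (z : Fin n → ℂ) : ℂ :=
  ((g.coeff x₀ z)⁻¹ * (jacobian m f x₀ z *
    (h.coeff (f x₀) (coordMap f x₀ z) * (jacobian m f x₀ z)ᴴ))).trace

theorem isHermitian_pullback {p q : ℕ} {K : Matrix (Fin p) (Fin q) ℂ} {H : Matrix (Fin q) (Fin q) ℂ}
    (hH : H.IsHermitian) : (K * (H * Kᴴ)).IsHermitian := by
  rw [← Matrix.mul_assoc]
  exact Matrix.isHermitian_mul_mul_conjTranspose K hH

/-- The Laplacian differentiates a real part; reality of the trace permits differentiating the trace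
itself. -/
theorem ofReal_re_trace_mul {p : ℕ} {A B : Matrix (Fin p) (Fin p) ℂ} (hA : A.IsHermitian)
    (hB : B.IsHermitian) : (((A * B).trace.re : ℝ) : ℂ) = (A * B).trace := by
  rw [← Complex.conj_eq_iff_re, starRingEnd_apply, ← Matrix.trace_conjTranspose,
    Matrix.conjTranspose_mul, hA.eq, hB.eq, Matrix.trace_mul_comm]

theorem energyDensity_eq_coordEnergy (hf : MDifferentiable 𝓘(ℂ, Fin n → ℂ) 𝓘(ℂ, Fin m → ℂ) f)
    (hz : z ∈ coordDomain (n := n) m f x₀) :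
    ((energyDensity g h f ((chartAt (Fin n → ℂ) x₀).symm z) : ℝ) : ℂ) =
      coordEnergy g h f x₀ z := by
  rw [energyDensity_chartAt_symm g h hf hz]
  exact ofReal_re_trace_mul (g.coeff_posDef hz.1).isHermitian.inv
    (isHermitian_pullback (h.coeff_posDef (coordMap_mem_target hz)).isHermitian)

theorem contDiffOn_coordEnergy (hf : MDifferentiable 𝓘(ℂ, Fin n → ℂ) 𝓘(ℂ, Fin m → ℂ) f) :
    ContDiffOn ℝ ∞ (coordEnergy g h f x₀) (coordDomain (n := n) m f x₀) := by
  have hG : MatrixSmoothOn (g.coeff x₀) (coordDomain (n := n) m f x₀) := fun a b =>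
    (g.matrixSmoothOn_coeff x₀ a b).mono inter_subset_left
  have hK := matrixSmoothOn_jacobian (x₀ := x₀) hf
  exact ((hG.inv fun w hw => g.isUnit_det_coeff hw.1).mul
    (hK.mul ((matrixSmoothOn_coeff_coordMap h hf).mul hK.conjTranspose))).contDiffOn_trace

/-- The components `∇_i f_k^α` of the Chern second fundamental form of the map. -/
noncomputable def hessianComp (g : HermitianMetric n X) (h : HermitianMetric m Y) (f : X → Y)
    (x₀ : X) (z : Fin n → ℂ) (i : Fin n) : Matrix (Fin n) (Fin m) ℂ :=
  matrixDeriv (-Complex.I) i (jacobian m f x₀) z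
    - matrixDeriv (-Complex.I) i (g.coeff x₀) z * (g.coeff x₀ z)⁻¹ * jacobian m f x₀ z
    + jacobian m f x₀ z * (matrixDeriv (-Complex.I) i
        (fun w => h.coeff (f x₀) (coordMap (n := n) (m := m) f x₀ w)) z
          * (h.coeff (f x₀) (coordMap f x₀ z))⁻¹)

/-- The trace computation with L = K*: its two first order factors become adjoint to each other, so
contraction with g will turn the first term into a squared norm. -/
theorem twistedDeriv_twistedDeriv_coordEnergy
    (hf : MDifferentiable 𝓘(ℂ, Fin n → ℂ) 𝓘(ℂ, Fin m → ℂ) f)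
    (hz : z ∈ coordDomain (n := n) m f x₀) (i j : Fin n) :
    twistedDeriv Complex.I j (twistedDeriv (-Complex.I) i (coordEnergy g h f x₀)) z =
      ((g.coeff x₀ z)⁻¹ * hessianComp g h f x₀ z i * h.coeff (f x₀) (coordMap f x₀ z) *
          (hessianComp g h f x₀ z j)ᴴ).trace
      + ((g.coeff x₀ z)⁻¹ * (Matrix.of fun k l => g.curvature x₀ i j k l z) * (g.coeff x₀ z)⁻¹ *
          (jacobian m f x₀ z * h.coeff (f x₀) (coordMap f x₀ z) * (jacobian m f x₀ z)ᴴ)).trace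
      - ((g.coeff x₀ z)⁻¹ * jacobian m f x₀ z *
          (∑ α, ∑ β, (jacobian m f x₀ z i α * (starRingEnd ℂ) (jacobian m f x₀ z j β)) •
            Matrix.of fun γ δ => h.curvature (f x₀) α β γ δ (coordMap f x₀ z)) *
          (jacobian m f x₀ z)ᴴ).trace := by
  have hU := isOpen_coordDomain (n := n) (m := m) (x₀ := x₀) hf.continuous
  have hG : MatrixSmoothOn (g.coeff x₀) (coordDomain (n := n) m f x₀) := fun a b =>
    (g.matrixSmoothOn_coeff x₀ a b).mono inter_subset_left
  have hK := matrixSmoothOn_jacobian (x₀ := x₀) hf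
  have hH := matrixSmoothOn_coeff_coordMap (x₀ := x₀) h hf
  have hGh : ∀ w ∈ coordDomain (n := n) m f x₀, (g.coeff x₀ w).IsHermitian := fun w hw =>
    (g.coeff_posDef hw.1).isHermitian
  have hHh : ∀ w ∈ coordDomain (n := n) m f x₀,
      (h.coeff (f x₀) (coordMap f x₀ w)).IsHermitian := fun w hw =>
    (h.coeff_posDef (coordMap_mem_target hw)).isHermitian
  have hL' : ∀ w ∈ coordDomain (n := n) m f x₀,
      matrixDeriv (-Complex.I) i (fun w => (jacobian m f x₀ w)ᴴ) w = 0 := fun w hw => by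
    rw [matrixDeriv_neg_I_conjTranspose, matrixDeriv_I_jacobian hf hw, Matrix.conjTranspose_zero]
  have key := twistedDeriv_twistedDeriv_trace hU hz hG hK hH hK.conjTranspose
    (fun w hw => g.isUnit_det_coeff hw.1) (h.isUnit_det_coeff (coordMap_mem_target hz))
    (fun w hw => matrixDeriv_I_jacobian hf hw j) hL' (matrixDeriv_matrixDeriv_jacobian hf hz i j)
  have hS : matrixDeriv Complex.I j (fun w => (jacobian m f x₀ w)ᴴ) z
        - (jacobian m f x₀ z)ᴴ * ((g.coeff x₀ z)⁻¹ * matrixDeriv Complex.I j (g.coeff x₀) z)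
        + (h.coeff (f x₀) (coordMap f x₀ z))⁻¹ * matrixDeriv Complex.I j
          (fun w => h.coeff (f x₀) (coordMap (n := n) (m := m) f x₀ w)) z * (jacobian m f x₀ z)ᴴ =
      (hessianComp g h f x₀ z j)ᴴ := by
    simp only [hessianComp, Matrix.conjTranspose_add, Matrix.conjTranspose_sub,
      Matrix.conjTranspose_mul, (hGh z hz).inv.eq, (hHh z hz).inv.eq, matrixDeriv_conjTranspose,
      matrixDeriv_I_of_isHermitian hU hz hGh j, matrixDeriv_I_of_isHermitian hU hz hHh j]
  have hR : -matrixDeriv Complex.I j (matrixDeriv (-Complex.I) i (g.coeff x₀)) z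
        + matrixDeriv (-Complex.I) i (g.coeff x₀) z * (g.coeff x₀ z)⁻¹
          * matrixDeriv Complex.I j (g.coeff x₀) z =
      Matrix.of fun k l => g.curvature x₀ i j k l z := by
    ext k l
    exact (g.curvature_eq hz.1 (fun w hw => g.isUnit_det_coeff hw) i j k l).symm
  -- The curvature expression of H ∘ F is the pullback of the curvature of H, since F holomorphic
  -- leaves no second derivatives of F.
  have hRH : -matrixDeriv Complex.I j (matrixDeriv (-Complex.I) i
        (fun w => h.coeff (f x₀) (coordMap (n := n) (m := m) f x₀ w))) z
        + matrixDeriv (-Complex.I) i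
            (fun w => h.coeff (f x₀) (coordMap (n := n) (m := m) f x₀ w)) z
          * (h.coeff (f x₀) (coordMap f x₀ z))⁻¹
          * matrixDeriv Complex.I j
            (fun w => h.coeff (f x₀) (coordMap (n := n) (m := m) f x₀ w)) z =
      ∑ α, ∑ β, (jacobian m f x₀ z i α * (starRingEnd ℂ) (jacobian m f x₀ z j β)) •
        Matrix.of fun γ δ => h.curvature (f x₀) α β γ δ (coordMap f x₀ z) := by
    have hcurv : ∀ α β, (Matrix.of fun γ δ => h.curvature (f x₀) α β γ δ (coordMap f x₀ z)) =
        -matrixDeriv Complex.I β (matrixDeriv (-Complex.I) α (h.coeff (f x₀))) (coordMap f x₀ z)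
        + matrixDeriv (-Complex.I) α (h.coeff (f x₀)) (coordMap f x₀ z)
          * (h.coeff (f x₀) (coordMap f x₀ z))⁻¹
          * matrixDeriv Complex.I β (h.coeff (f x₀)) (coordMap f x₀ z) := by
      intro α β
      ext γ δ
      exact h.curvature_eq (coordMap_mem_target hz) (fun w hw => h.isUnit_det_coeff hw) α β γ δ
    have hbar : ∀ β, (matrixDeriv (-Complex.I) β (h.coeff (f x₀)) (coordMap f x₀ z))ᴴ =
        matrixDeriv Complex.I β (h.coeff (f x₀)) (coordMap f x₀ z) := fun β =>
      (matrixDeriv_I_of_isHermitian (chartAt (Fin m → ℂ) (f x₀)).open_target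
        (coordMap_mem_target hz) (fun w hw => (h.coeff_posDef hw).isHermitian) β).symm
    simp only [hcurv, smul_add, smul_neg, Finset.sum_add_distrib, Finset.sum_neg_distrib]
    rw [matrixDeriv_matrixDeriv_coeff_coordMap h hf hz, matrixDeriv_I_of_isHermitian hU hz hHh,
      matrixDeriv_coeff_coordMap h hf hz, matrixDeriv_coeff_coordMap h hf hz]
    simp only [Matrix.conjTranspose_sum, Matrix.conjTranspose_smul, hbar, Matrix.sum_mul,
      Matrix.mul_sum, Matrix.smul_mul, Matrix.mul_smul, Finset.smul_sum, smul_smul]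
    congr 1
    rw [Finset.sum_comm]
    refine Finset.sum_congr rfl fun α _ => Finset.sum_congr rfl fun β _ => ?_
    rw [starRingEnd_apply, mul_comm]
  rw [hS, hR, hRH] at key
  exact key

/-- The antisymmetric part of the second fundamental form is given by the torsions. -/
theorem hessianComp_antisymm (hf : MDifferentiable 𝓘(ℂ, Fin n → ℂ) 𝓘(ℂ, Fin m → ℂ) f)
    (hz : z ∈ coordDomain (n := n) m f x₀) (i k : Fin n) (a : Fin m) :
    hessianComp g h f x₀ z i k a - hessianComp g h f x₀ z k i a =
      (∑ β, ∑ γ, jacobian m f x₀ z i β * jacobian m f x₀ z k γ *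
        h.torsion (f x₀) β γ a (coordMap f x₀ z))
      - ∑ p, g.torsion x₀ i k p z * jacobian m f x₀ z p a := by
  have h1 : ∀ i k, (jacobian m f x₀ z * (matrixDeriv (-Complex.I) i
        (fun w => h.coeff (f x₀) (coordMap (n := n) (m := m) f x₀ w)) z
          * (h.coeff (f x₀) (coordMap f x₀ z))⁻¹)) k a =
      ∑ β, ∑ γ, jacobian m f x₀ z i β * jacobian m f x₀ z k γ *
        (matrixDeriv (-Complex.I) β (h.coeff (f x₀)) (coordMap f x₀ z) *
          (h.coeff (f x₀) (coordMap f x₀ z))⁻¹) γ a := by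
    intro i k
    rw [matrixDeriv_coeff_coordMap h hf hz, Matrix.sum_mul, Matrix.mul_sum, Matrix.sum_apply]
    refine Finset.sum_congr rfl fun β _ => ?_
    rw [Matrix.smul_mul, Matrix.mul_smul, Matrix.smul_apply, Matrix.mul_apply, smul_eq_mul,
      Finset.mul_sum]
    exact Finset.sum_congr rfl fun γ _ => (mul_assoc _ _ _).symm
  simp only [hessianComp, Matrix.add_apply, Matrix.sub_apply]
  -- The second derivatives of f cancel; only differences of Christoffel symbols, the torsions,
  -- remain.
  rw [h1 i k, h1 k i, matrixDeriv_jacobian_symm hf hz i k,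
    Finset.sum_comm (f := fun β γ => jacobian m f x₀ z k β * jacobian m f x₀ z i γ * _)]
  simp only [HermitianMetric.torsion_eq, mul_sub, sub_mul, Finset.sum_sub_distrib]
  rw [Matrix.mul_apply, Matrix.mul_apply]
  have h2 : ∀ β γ, jacobian m f x₀ z k β * jacobian m f x₀ z i γ =
    jacobian m f x₀ z i γ * jacobian m f x₀ z k β := fun β γ => mul_comm _ _
  simp only [h2 _ _]
  ring

end Bochner

/-! ### Contraction with the metric and use of the curvature bounds -/

section Pointwise

variable {n m : ℕ} {X Y : Type*} [TopologicalSpace X] [ChartedSpace (Fin n → ℂ) X]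
  [TopologicalSpace Y] [ChartedSpace (Fin m → ℂ) Y]

/-- The numerator of the tempered real bisectional curvature, split into its curvature and torsion
parts. -/
theorem re_sum_temperedRBC (h : HermitianMetric m Y) (τ : ℝ) (y : Y) (Ξ : Matrix (Fin m) (Fin m) ℂ) :
    (∑ α, ∑ β, ∑ γ, ∑ δ,
      (h.curvature y α β γ δ (chartAt (Fin m → ℂ) y y)
        - (((1 - τ) / 4 : ℝ) : ℂ) * ∑ ρ, ∑ σ,
            h.torsion y α γ ρ (chartAt (Fin m → ℂ) y y)
              * (starRingEnd ℂ) (h.torsion y β δ σ (chartAt (Fin m → ℂ) y y))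
              * h.coeff y (chartAt (Fin m → ℂ) y y) ρ σ) * Ξᵀ α β * Ξᵀ γ δ).re =
      (∑ α, ∑ β, ∑ γ, ∑ δ, h.curvature y α β γ δ (chartAt (Fin m → ℂ) y y) * Ξᵀ α β * Ξᵀ γ δ).re
      - (1 - τ) / 4 * quadForm (tensorMetric Ξ (h.coeff y (chartAt (Fin m → ℂ) y y)))
          (tensorVec fun α γ ρ => h.torsion y α γ ρ (chartAt (Fin m → ℂ) y y)) := by
  rw [quadForm_tensorVec, ← Complex.re_ofReal_mul, ← Complex.sub_re]
  refine congrArg Complex.re ?_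
  simp only [Finset.mul_sum, Finset.sum_mul, ← Finset.sum_sub_distrib, sub_mul]
  iterate 4 refine Finset.sum_congr rfl fun _ _ => ?_
  refine congrArg₂ _ rfl ?_
  iterate 2 refine Finset.sum_congr rfl fun _ _ => ?_
  simp only [Matrix.transpose_apply]
  ring

theorem tensorNormSq_transpose (h : HermitianMetric m Y) (y : Y) {Ξ : Matrix (Fin m) (Fin m) ℂ}
    (hΞ : Ξ.IsHermitian) : h.tensorNormSq y Ξᵀ =
      (h.coeff y (chartAt (Fin m → ℂ) y y) * Ξ *
        (h.coeff y (chartAt (Fin m → ℂ) y y) * Ξ)).trace.re := by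
  rw [← sum_eq_trace_of_isHermitian _ _ hΞ]
  rfl

theorem TemperedRBCUpperBound.le_trace [IsManifold 𝓘(ℂ, Fin m → ℂ) 1 Y] {h : HermitianMetric m Y}
    {τ κ₀ : ℝ} (hRBC : TemperedRBCUpperBound h τ (-κ₀)) (y : Y)
    {Ξ : Matrix (Fin m) (Fin m) ℂ} (hΞ : Ξ.PosSemidef) :
    (∑ α, ∑ β, ∑ γ, ∑ δ, h.curvature y α β γ δ (chartAt (Fin m → ℂ) y y) * Ξᵀ α β * Ξᵀ γ δ).re
      - (1 - τ) / 4 * quadForm (tensorMetric Ξ (h.coeff y (chartAt (Fin m → ℂ) y y)))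
          (tensorVec fun α γ ρ => h.torsion y α γ ρ (chartAt (Fin m → ℂ) y y)) ≤
      -κ₀ * (h.coeff y (chartAt (Fin m → ℂ) y y) * Ξ *
        (h.coeff y (chartAt (Fin m → ℂ) y y) * Ξ)).trace.re := by
  rw [← re_sum_temperedRBC]
  -- The curvature bound excludes ξ = 0, but there both sides vanish.
  by_cases h0 : Ξ = 0
  · simp [h0]
  have h1 := hRBC y Ξᵀ hΞ.transpose (by simpa using h0)
  have h2 := trace_mul_mul_self_pos (h.coeff_posDef (mem_chart_target _ y)) hΞ.isHermitian h0
  rw [← tensorNormSq_transpose h y hΞ.isHermitian] at h2 ⊢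
  rw [HermitianMetric.temperedRBC, div_le_iff₀ h2] at h1
  exact h1

theorem coordMap_self (f : X → Y) (x : X) :
    coordMap (n := n) (m := m) f x (chartAt (Fin n → ℂ) x x) =
      chartAt (Fin m → ℂ) (f x) (f x) := by
  rw [coordMap, (chartAt (Fin n → ℂ) x).left_inv (mem_chart_source _ x)]

variable [IsManifold 𝓘(ℂ, Fin n → ℂ) 1 X]

theorem HermitianMetric.formAt_self (g : HermitianMetric n X) (x : X) (v w : Fin n → ℂ) :
    g.formAt x v w = ∑ k, ∑ l, g.coeff x (chartAt (Fin n → ℂ) x x) k l * v k *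
      (starRingEnd ℂ) (w l) := by
  have h1 := g.formAt_chartSymmDeriv x (chartAt (Fin n → ℂ) x x) v w
  rwa [chartSymmDeriv_self, chartSymmDeriv_self,
    (chartAt (Fin n → ℂ) x).left_inv (mem_chart_source _ x)] at h1

variable [IsManifold 𝓘(ℂ, Fin m → ℂ) 1 Y] {f : X → Y}

theorem formAt_differentialAt_self (h : HermitianMetric m Y)
    (hf : MDifferentiable 𝓘(ℂ, Fin n → ℂ) 𝓘(ℂ, Fin m → ℂ) f) (x : X) (v : Fin n → ℂ) :
    h.formAt (f x) (differentialAt (m := m) f x v) (differentialAt (m := m) f x v) =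
      ∑ k, ∑ l, (jacobian m f x (chartAt (Fin n → ℂ) x x) *
        (h.coeff (f x) (coordMap f x (chartAt (Fin n → ℂ) x x)) *
          (jacobian m f x (chartAt (Fin n → ℂ) x x))ᴴ)) k l * v k * (starRingEnd ℂ) (v l) := by
  conv_lhs => rw [← sum_smul_single v]
  simp only [map_sum (differentialAt (m := m) f x), map_smul (differentialAt (m := m) f x)]
  rw [sesqForm_expand]
  refine Finset.sum_congr rfl fun k _ => Finset.sum_congr rfl fun l _ => ?_
  have h1 := formAt_differentialAt hf h (mem_coordDomain_self (n := n) (m := m) f x) k l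
  rw [chartSymmDeriv_self, chartSymmDeriv_self,
    (chartAt (Fin n → ℂ) x).left_inv (mem_chart_source _ x)] at h1
  rw [h1]

/-- The inequality of Hermitian forms is paired with the positive semidefinite W = G⁻¹PG⁻¹, which is
P with its indices raised. -/
theorem TemperedRicciLowerBound.le_trace {g : HermitianMetric n X} {h : HermitianMetric m Y}
    {τ C₁ C₂ : ℝ} (hRic : TemperedRicciLowerBound g h f τ C₁ C₂)
    (hf : MDifferentiable 𝓘(ℂ, Fin n → ℂ) 𝓘(ℂ, Fin m → ℂ) f) (x : X)
    {z : Fin n → ℂ} (hz : z = chartAt (Fin n → ℂ) x x) {P : Matrix (Fin n) (Fin n) ℂ}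
    (hP : P = jacobian m f x z * (h.coeff (f x) (coordMap f x z) * (jacobian m f x z)ᴴ)) :
    -C₁ * ((g.coeff x z)⁻¹ * P).trace.re
      + C₂ * (P * ((g.coeff x z)⁻¹ * P * (g.coeff x z)⁻¹)).trace.re ≤
    ((Matrix.of fun k l => g.ricciTwo x k l z) *
        ((g.coeff x z)⁻¹ * P * (g.coeff x z)⁻¹)).trace.re
      + (1 - 1 / τ) / 4 * quadForm (tensorMetric (g.coeff x z)⁻¹ P)
        (tensorVec fun i k p => g.torsion x i k p z) := by
  have hzt : z ∈ (chartAt (Fin n → ℂ) x).target := hz ▸ mem_chart_target _ x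
  have hzd : z ∈ coordDomain (n := n) m f x := hz ▸ mem_coordDomain_self f x
  set G := g.coeff x z with hG
  have hGpd : G.PosDef := g.coeff_posDef hzt
  have hdet : IsUnit G.det := g.isUnit_det_coeff hzt
  have hPpsd : P.PosSemidef := by
    rw [hP, ← Matrix.mul_assoc]
    exact (h.coeff_posDef (coordMap_mem_target hzd)).posSemidef.mul_mul_conjTranspose_same _
  set W := G⁻¹ * P * G⁻¹ with hW
  have hWpsd : W.PosSemidef := by
    have h1 := hPpsd.mul_mul_conjTranspose_same G⁻¹
    rwa [hGpd.isHermitian.inv.eq] at h1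
  set R : Matrix (Fin n) (Fin n) ℂ := Matrix.of fun k l => g.ricciTwo x k l z
  set Q : Matrix (Fin n) (Fin n) ℂ := Matrix.of fun k l => g.torsionSq x k l z with hQ
  have hpos := re_trace_mul_nonneg (A := R + (((1 - 1 / τ) / 4 : ℝ) : ℂ) • Q + (C₁ : ℂ) • G
    - (C₂ : ℂ) • P) hWpsd (by
      intro v
      have h1 := hRic x v
      have h2 : g.form x v v = g.formAt x v v := rfl
      have h3 : h.form (f x) (differential (n := n) (m := m) f x v)
          (differential (n := n) (m := m) f x v) =
          h.formAt (f x) (differentialAt (m := m) f x v) (differentialAt (m := m) f x v) := rfl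
      rw [h2, h3, formAt_differentialAt_self h hf, g.formAt_self, HermitianMetric.temperedRicci,
        ← hz, ← hP, ← hG] at h1
      have h4 : ∑ k, ∑ l, (R + (((1 - 1 / τ) / 4 : ℝ) : ℂ) • Q + (C₁ : ℂ) • G - (C₂ : ℂ) • P) k l
          * v k * (starRingEnd ℂ) (v l) =
          (∑ k, ∑ l, (g.ricciTwo x k l z + (((1 - 1 / τ) / 4 : ℝ) : ℂ) * g.torsionSq x k l z)
            * v k * (starRingEnd ℂ) (v l))
          + C₁ * (∑ k, ∑ l, G k l * v k * (starRingEnd ℂ) (v l))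
          - C₂ * ∑ k, ∑ l, P k l * v k * (starRingEnd ℂ) (v l) := by
        simp only [Finset.mul_sum, ← Finset.sum_add_distrib, ← Finset.sum_sub_distrib]
        refine Finset.sum_congr rfl fun k _ => Finset.sum_congr rfl fun l _ => ?_
        simp only [Matrix.add_apply, Matrix.sub_apply, Matrix.smul_apply, smul_eq_mul, R, Q,
          Matrix.of_apply]
        ring
      rw [h4, Complex.sub_re, Complex.add_re, Complex.re_ofReal_mul, Complex.re_ofReal_mul]
      linarith)
  have e1 : (Q * W).trace.re = quadForm (tensorMetric G⁻¹ P)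
      (tensorVec fun i k p => g.torsion x i k p z) := by
    have h1 := trace_quadratic_torsion G⁻¹ G W fun i k p => g.torsion x i k p z
    have h2 : G * W * G = P := by
      rw [hW, ← Matrix.mul_assoc, ← Matrix.mul_assoc, Matrix.mul_nonsing_inv _ hdet, Matrix.one_mul,
        Matrix.mul_assoc, Matrix.nonsing_inv_mul _ hdet, Matrix.mul_one]
    rw [h2] at h1
    exact h1
  have e2 : (G * W).trace = (G⁻¹ * P).trace := by
    rw [hW, ← Matrix.mul_assoc, ← Matrix.mul_assoc, Matrix.mul_nonsing_inv _ hdet, Matrix.one_mul,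
      Matrix.trace_mul_comm]
  simp only [Matrix.add_mul, Matrix.sub_mul, Matrix.smul_mul, Matrix.trace_add, Matrix.trace_sub,
    Matrix.trace_smul, smul_eq_mul, Complex.add_re, Complex.sub_re, Complex.re_ofReal_mul, e1,
    e2] at hpos
  linarith

/-- The Bochner formula: squared Hessian, Ricci term of the source, curvature term of the target. -/
theorem laplacian_energyDensity (g : HermitianMetric n X) (h : HermitianMetric m Y)
    (hf : MDifferentiable 𝓘(ℂ, Fin n → ℂ) 𝓘(ℂ, Fin m → ℂ) f) (x : X)
    {z : Fin n → ℂ} (hz : z = chartAt (Fin n → ℂ) x x) {P : Matrix (Fin n) (Fin n) ℂ}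
    (hP : P = jacobian m f x z * (h.coeff (f x) (coordMap f x z) * (jacobian m f x z)ᴴ)) :
    g.laplacian (energyDensity g h f) x =
      quadForm (tensorMetric (g.coeff x z)⁻¹ (h.coeff (f x) (coordMap f x z)))
        (tensorVec fun i k a => hessianComp g h f x z i k a)
      + ((Matrix.of fun k l => g.ricciTwo x k l z) *
        ((g.coeff x z)⁻¹ * P * (g.coeff x z)⁻¹)).trace.re
      - (∑ α, ∑ β, ∑ γ, ∑ δ, h.curvature (f x) α β γ δ (coordMap f x z) *
          ((jacobian m f x z)ᴴ * (g.coeff x z)⁻¹ * jacobian m f x z)ᵀ α β *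
          ((jacobian m f x z)ᴴ * (g.coeff x z)⁻¹ * jacobian m f x z)ᵀ γ δ).re := by
  have hzd : z ∈ coordDomain (n := n) m f x := hz ▸ mem_coordDomain_self f x
  have hU := isOpen_coordDomain (n := n) (m := m) (x₀ := x) hf.continuous
  have hev : (fun w => ((energyDensity g h f ((chartAt (Fin n → ℂ) x).symm w) : ℝ) : ℂ))
      =ᶠ[𝓝 z] coordEnergy g h f x := by
    filter_upwards [hU.mem_nhds hzd] with w hw using energyDensity_eq_coordEnergy g h hf hw
  have hsm : ContDiffAt ℝ 2 (coordEnergy g h f x) z :=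
    ((contDiffOn_coordEnergy g h hf).contDiffAt (hU.mem_nhds hzd)).of_le ENat.LEInfty.out
  -- The Laplacian applies ∂̄_j before ∂_i, the trace computation the reverse; symmetry of second
  -- derivatives reconciles them.
  have hterm : ∀ i j, wirtinger i (wirtingerBar j fun w =>
      ((energyDensity g h f ((chartAt (Fin n → ℂ) x).symm w) : ℝ) : ℂ)) z =
      twistedDeriv Complex.I j (twistedDeriv (-Complex.I) i (coordEnergy g h f x)) z := by
    intro i j
    rw [wirtinger_eq_twistedDeriv, wirtingerBar_eq_twistedDeriv,
      twistedDeriv_congr (twistedDeriv_eventuallyEq hev), twistedDeriv_comm hsm]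
  have hric : (Matrix.of fun k l => g.ricciTwo x k l z) =
      ∑ i, ∑ j, (g.coeff x z)⁻¹ j i • Matrix.of fun k l => g.curvature x i j k l z := by
    ext k l
    simp [Matrix.sum_apply, HermitianMetric.ricciTwo, HermitianMetric.invCoeff]
  rw [HermitianMetric.laplacian, ← hz]
  simp only [hterm, twistedDeriv_twistedDeriv_coordEnergy g h hf hzd, HermitianMetric.invCoeff,
    Matrix.transpose_apply, mul_add, mul_sub, Finset.sum_add_distrib, Finset.sum_sub_distrib]
  rw [Complex.sub_re, Complex.add_re, re_sum_trace_eq_quadForm, sum_trace_curvature,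
    sum_trace_pullback_curvature, hric, hP, Matrix.mul_assoc (jacobian m f x z)]
  rfl

/-- The Bochner inequality with the Hilbert-Schmidt norm of the pulled back metric. -/
theorem le_laplacian_energyDensity (g : HermitianMetric n X) (h : HermitianMetric m Y)
    (hf : MDifferentiable 𝓘(ℂ, Fin n → ℂ) 𝓘(ℂ, Fin m → ℂ) f) {τ C₁ C₂ κ₀ : ℝ} (hτ : 0 < τ)
    (hRic : TemperedRicciLowerBound g h f τ C₁ C₂) (hRBC : TemperedRBCUpperBound h τ (-κ₀)) (x : X)
    {z : Fin n → ℂ} (hz : z = chartAt (Fin n → ℂ) x x) {P : Matrix (Fin n) (Fin n) ℂ}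
    (hP : P = jacobian m f x z * (h.coeff (f x) (coordMap f x z) * (jacobian m f x z)ᴴ)) :
    -C₁ * ((g.coeff x z)⁻¹ * P).trace.re
      + (κ₀ + C₂) * (P * ((g.coeff x z)⁻¹ * P * (g.coeff x z)⁻¹)).trace.re ≤
      g.laplacian (energyDensity g h f) x := by
  have hzt : z ∈ (chartAt (Fin n → ℂ) x).target := hz ▸ mem_chart_target _ x
  have hzd : z ∈ coordDomain (n := n) m f x := hz ▸ mem_coordDomain_self f x
  have hF : coordMap f x z = chartAt (Fin m → ℂ) (f x) (f x) := hz ▸ coordMap_self f x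
  have hg := (g.coeff_posDef hzt).inv.posSemidef
  have hH := (h.coeff_posDef (coordMap_mem_target hzd)).posSemidef
  have h1 := hRic.le_trace hf x hz hP
  have h2 := hRBC.le_trace (f x) (hg.conjTranspose_mul_mul_same (jacobian m f x z))
  rw [← hF] at h2
  have h3 := quadForm_antisymm_le hg hH fun i k a => hessianComp g h f x z i k a
  simp only [hessianComp_antisymm g h hf hzd] at h3
  -- After the factor 1/4 of `h3`, the coefficients (1 − τ)/4 and (1 − 1/τ)/4 match the torsion
  -- terms of `h2` and `h1`, which therefore cancel in the final sum.
  have h4 := le_quadForm_sub (posSemidef_tensorMetric hg hH)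
    (tensorVec fun i k a => ∑ β, ∑ γ, jacobian m f x z i β * jacobian m f x z k γ *
        h.torsion (f x) β γ a (coordMap f x z))
    (tensorVec fun i k a => ∑ p, g.torsion x i k p z * jacobian m f x z p a) hτ
  rw [quadForm_pullback, quadForm_pushforward, Matrix.mul_assoc (jacobian m f x z), ← hP] at h4
  have h5 : tensorVec (fun i k a => (∑ β, ∑ γ, jacobian m f x z i β * jacobian m f x z k γ *
        h.torsion (f x) β γ a (coordMap f x z))
        - ∑ p, g.torsion x i k p z * jacobian m f x z p a) =
      tensorVec (fun i k a => ∑ β, ∑ γ, jacobian m f x z i β * jacobian m f x z k γ *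
        h.torsion (f x) β γ a (coordMap f x z)) -
      tensorVec fun i k a => ∑ p, g.torsion x i k p z * jacobian m f x z p a := rfl
  rw [h5] at h3
  -- Both are |f*h|², computed on the target and on the source.
  have h6 : (h.coeff (f x) (coordMap f x z) *
      ((jacobian m f x z)ᴴ * (g.coeff x z)⁻¹ * jacobian m f x z) *
      (h.coeff (f x) (coordMap f x z) *
        ((jacobian m f x z)ᴴ * (g.coeff x z)⁻¹ * jacobian m f x z))).trace =
      (P * ((g.coeff x z)⁻¹ * P * (g.coeff x z)⁻¹)).trace := by
    rw [hP]
    simp only [Matrix.mul_assoc]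
    rw [Matrix.trace_mul_comm (jacobian m f x z)]
    simp only [Matrix.mul_assoc]
  rw [h6] at h2
  rw [laplacian_energyDensity g h hf x hz hP]
  linarith

end Pointwise

/-! ### The Laplacian at a local maximum -/

section MaximumPrinciple

/-- Along a line, a positive second derivative would make the maximum also a local minimum, hence
the function locally constant and its second derivative zero. -/
theorem re_fderiv_fderiv_nonpos_of_isLocalMax {E : Type*} [NormedAddCommGroup E] [NormedSpace ℝ E]
    {φ : E → ℂ} {z : E} (hφ : ContDiffAt ℝ 2 φ z) (hmax : IsLocalMax (fun w => (φ w).re) z) (v : E) :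
    (fderiv ℝ (fderiv ℝ φ) z v v).re ≤ 0 := by
  have hline : ∀ t : ℝ, HasDerivAt (fun t : ℝ => z + t • v) v t := fun t => by
    simpa using ((hasDerivAt_id t).smul_const v).const_add z
  have htend : Tendsto (fun t : ℝ => z + t • v) (𝓝 0) (𝓝 z) := by
    have := (hline 0).continuousAt.tendsto
    simpa using this
  set p : ℝ → ℝ := fun t => (φ (z + t • v)).re with hp
  have hd1 : ∀ᶠ w in 𝓝 z, DifferentiableAt ℝ φ w :=
    (hφ.eventually (by simp)).mono fun w hw => hw.differentiableAt (by norm_num)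
  have hder : ∀ᶠ t in 𝓝 (0 : ℝ), _root_.deriv p t = (fderiv ℝ φ (z + t • v) v).re := by
    filter_upwards [htend.eventually hd1] with t ht
    exact (Complex.reCLM.hasFDerivAt.comp_hasDerivAt t
      (ht.hasFDerivAt.comp_hasDerivAt t (hline t))).deriv
  have hd2 : DifferentiableAt ℝ (fderiv ℝ φ) z :=
    (hφ.fderiv_right (m := 1) (by norm_num)).differentiableAt (by norm_num)
  have hd2' : HasFDerivAt (fun w => fderiv ℝ φ w v)
      ((ContinuousLinearMap.apply ℝ ℂ v).comp (fderiv ℝ (fderiv ℝ φ) z)) z :=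
    (ContinuousLinearMap.apply ℝ ℂ v).hasFDerivAt.comp z hd2.hasFDerivAt
  have hsecond : _root_.deriv (_root_.deriv p) 0 = (fderiv ℝ (fderiv ℝ φ) z v v).re := by
    rw [Filter.EventuallyEq.deriv_eq hder]
    have h0 : z = z + (0 : ℝ) • v := by simp
    rw [h0] at hd2'
    have := (Complex.reCLM.hasFDerivAt.comp_hasDerivAt (0 : ℝ)
      (hd2'.comp_hasDerivAt (0 : ℝ) (hline 0))).deriv
    rw [← h0] at this
    exact this
  have hpmax : IsLocalMax p 0 := by
    have h1 := htend.eventually hmax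
    filter_upwards [h1] with t ht
    simpa [hp] using ht
  by_contra! hpos
  rw [← hsecond] at hpos
  have hcont : ContinuousAt p 0 := by
    have h0 : ContinuousAt φ (z + (0 : ℝ) • v) := by simpa using hφ.continuousAt
    exact Complex.continuous_re.continuousAt.comp
      (ContinuousAt.comp (f := fun t : ℝ => z + t • v) h0 (hline 0).continuousAt)
  have hpmin := isLocalMin_of_deriv_deriv_pos hpos hpmax.deriv_eq_zero hcont
  have hconst : p =ᶠ[𝓝 0] fun _ => p 0 := by
    filter_upwards [hpmax, hpmin] with t h1 h2 using le_antisymm h1 h2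
  have h1 : _root_.deriv p =ᶠ[𝓝 0] fun _ => 0 := by
    have := hconst.deriv
    simpa using this
  rw [h1.deriv_eq] at hpos
  simp at hpos

/-- The Levi form is a quarter of the real Hessian on v plus that on √-1 v; the mixed terms cancel
by symmetry. -/
theorem sum_wirtinger_wirtingerBar {n : ℕ} {φ : (Fin n → ℂ) → ℂ} {z : Fin n → ℂ}
    (hφ : ContDiffAt ℝ 2 φ z) (v : Fin n → ℂ) :
    ∑ k, ∑ l, wirtinger k (wirtingerBar l φ) z * v k * (starRingEnd ℂ) (v l) =
      (1 / 4) * (fderiv ℝ (fderiv ℝ φ) z v v +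
        fderiv ℝ (fderiv ℝ φ) z (Complex.I • v) (Complex.I • v)) := by
  set B := fderiv ℝ (fderiv ℝ φ) z
  have hs : IsSymmSndFDerivAt ℝ φ z := hφ.isSymmSndFDerivAt (by simp)
  have h1 : ∀ l, ∑ k, v k * wirtinger k (wirtingerBar l φ) z =
      1 / 2 * (fderiv ℝ (wirtingerBar l φ) z v
        - Complex.I * fderiv ℝ (wirtingerBar l φ) z (Complex.I • v)) := by
    intro l
    rw [realLinear_sub_I_mul, Finset.mul_sum]
    exact Finset.sum_congr rfl fun k _ => by rw [wirtinger]; ring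
  have h2 : ∀ w : Fin n → ℂ, ∑ l, (starRingEnd ℂ) (v l) * fderiv ℝ (wirtingerBar l φ) z w =
      1 / 2 * (B w v + Complex.I * B w (Complex.I • v)) := by
    intro w
    rw [realLinear_add_I_mul, Finset.mul_sum]
    refine Finset.sum_congr rfl fun l _ => ?_
    rw [wirtingerBar_eq_twistedDeriv, fderiv_twistedDeriv_apply hφ]
    ring
  have h3 : ∑ k, ∑ l, wirtinger k (wirtingerBar l φ) z * v k * (starRingEnd ℂ) (v l) =
      1 / 2 * (∑ l, (starRingEnd ℂ) (v l) * fderiv ℝ (wirtingerBar l φ) z v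
        - Complex.I * ∑ l, (starRingEnd ℂ) (v l) *
          fderiv ℝ (wirtingerBar l φ) z (Complex.I • v)) := by
    rw [Finset.sum_comm, Finset.mul_sum, ← Finset.sum_sub_distrib, Finset.mul_sum]
    refine Finset.sum_congr rfl fun l _ => ?_
    have h4 := h1 l
    calc _ = (starRingEnd ℂ) (v l) * ∑ k, v k * wirtinger k (wirtingerBar l φ) z := by
          rw [Finset.mul_sum]
          exact Finset.sum_congr rfl fun k _ => by ring
      _ = _ := by rw [h4]; ring
  rw [h3, h2, h2]
  have h5 : B (Complex.I • v) v = B v (Complex.I • v) := hs.eq _ _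
  rw [h5]
  linear_combination (-1 / 4 * B (Complex.I • v) (Complex.I • v)) * Complex.I_mul_I

/-- The complex Laplacian is nonpositive at a local maximum. -/
theorem HermitianMetric.laplacian_nonpos_of_isLocalMax {n : ℕ} {X : Type*} [TopologicalSpace X]
    [ChartedSpace (Fin n → ℂ) X] [IsManifold 𝓘(ℂ, Fin n → ℂ) 1 X] (g : HermitianMetric n X)
    {u : X → ℝ} {x : X}
    (hu : ContDiffAt ℝ 2 (fun z => ((u ((chartAt (Fin n → ℂ) x).symm z) : ℝ) : ℂ))
      (chartAt (Fin n → ℂ) x x))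
    (hmax : IsLocalMax (fun z => u ((chartAt (Fin n → ℂ) x).symm z)) (chartAt (Fin n → ℂ) x x)) :
    g.laplacian u x ≤ 0 := by
  set z := chartAt (Fin n → ℂ) x x with hz
  set φ : (Fin n → ℂ) → ℂ := fun z => ((u ((chartAt (Fin n → ℂ) x).symm z) : ℝ) : ℂ) with hφ
  set A : Matrix (Fin n) (Fin n) ℂ := Matrix.of fun i j => wirtinger i (wirtingerBar j φ) z with hA
  have hg := (g.coeff_posDef (mem_chart_target _ x)).inv.posSemidef
  have hφmax : IsLocalMax (fun w => (φ w).re) z := hmax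
  have h1 := re_trace_mul_nonneg (A := -A) hg (by
    intro v
    have h2 := sum_wirtinger_wirtingerBar hu v
    have h3 := re_fderiv_fderiv_nonpos_of_isLocalMax hu hφmax v
    have h4 := re_fderiv_fderiv_nonpos_of_isLocalMax hu hφmax (Complex.I • v)
    have h5 : ∑ k, ∑ l, (-A) k l * v k * (starRingEnd ℂ) (v l) =
        -∑ k, ∑ l, wirtinger k (wirtingerBar l φ) z * v k * (starRingEnd ℂ) (v l) := by
      simp only [hA, Matrix.neg_apply, Matrix.of_apply, neg_mul, Finset.sum_neg_distrib]
    have h6 : ((1 / 4 : ℝ) : ℂ) = 1 / 4 := by norm_num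
    rw [h5, h2, ← h6, Complex.neg_re, Complex.re_ofReal_mul, Complex.add_re]
    linarith)
  have h7 : g.laplacian u x = (A * (g.coeff x z)⁻¹).trace.re := by
    simp only [HermitianMetric.laplacian, HermitianMetric.invCoeff, Matrix.trace, Matrix.diag,
      Matrix.mul_apply, Matrix.transpose_apply, hA, Matrix.of_apply, ← hz]
    refine congrArg Complex.re ?_
    exact Finset.sum_congr rfl fun _ _ => Finset.sum_congr rfl fun _ _ => mul_comm _ _
  rw [Matrix.neg_mul, Matrix.trace_neg, Complex.neg_re] at h1
  rw [h7]
  linarith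

end MaximumPrinciple

/-! ### The final inequality and the Schwarz lemma -/

section Energy

/-- With g = B*B and H = C*C the trace is the squared Frobenius norm of BKC*, and B, C are
invertible. -/
theorem trace_mul_pullback_pos {ι κ : Type*} [Fintype ι] [Fintype κ] [DecidableEq ι]
    [DecidableEq κ] {g : Matrix ι ι ℂ} {H : Matrix κ κ ℂ} (hg : g.PosDef) (hH : H.PosDef)
    {K : Matrix ι κ ℂ} (hK : K ≠ 0) : 0 < (g * (K * (H * Kᴴ))).trace.re := by
  obtain ⟨B, rfl⟩ := exists_eq_conjTranspose_mul_self hg.posSemidef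
  obtain ⟨C, rfl⟩ := exists_eq_conjTranspose_mul_self hH.posSemidef
  have hB : IsUnit B.det := by
    have := (Matrix.isUnit_iff_isUnit_det _).1 hg.isUnit
    rw [Matrix.det_mul] at this
    exact (IsUnit.mul_iff.1 this).2
  have hC : IsUnit (Cᴴ).det := by
    have := (Matrix.isUnit_iff_isUnit_det _).1 hH.isUnit
    rw [Matrix.det_mul] at this
    exact (IsUnit.mul_iff.1 this).1
  set Q := B * K * Cᴴ with hQ
  have h1 : (Bᴴ * B * (K * (Cᴴ * C * Kᴴ))).trace = (Q * Qᴴ).trace := by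
    rw [hQ]
    simp only [Matrix.conjTranspose_mul, Matrix.conjTranspose_conjTranspose, Matrix.mul_assoc]
    rw [Matrix.trace_mul_comm]
    simp only [Matrix.mul_assoc]
  have h2 : 0 ≤ (Q * Qᴴ).trace := (Matrix.posSemidef_self_mul_conjTranspose Q).trace_nonneg
  have h3 : (Q * Qᴴ).trace ≠ 0 := by
    rw [Ne, Matrix.trace_mul_conjTranspose_self_eq_zero_iff]
    intro hQ0
    apply hK
    have h4 : B⁻¹ * Q * (Cᴴ)⁻¹ = K := by
      rw [hQ, ← Matrix.mul_assoc, ← Matrix.mul_assoc, Matrix.nonsing_inv_mul _ hB, Matrix.one_mul,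
        Matrix.mul_assoc, Matrix.mul_nonsing_inv _ hC, Matrix.mul_one]
    rw [← h4, hQ0, Matrix.mul_zero, Matrix.zero_mul]
  rw [h1]
  exact (Complex.lt_def.1 (lt_of_le_of_ne h2 h3.symm)).1

variable {n m : ℕ} {X Y : Type*} [TopologicalSpace X] [ChartedSpace (Fin n → ℂ) X]
  [TopologicalSpace Y] [ChartedSpace (Fin m → ℂ) Y]

theorem HasRank.le_left {f : X → Y} {r : ℕ} (hr : HasRank (n := n) (m := m) f r) : r ≤ n := by
  obtain ⟨x, hx⟩ := hr.1
  have h1 := LinearMap.finrank_range_le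
    (differentialAt (n := n) (m := m) f x : (Fin n → ℂ) →ₗ[ℂ] (Fin m → ℂ))
  rw [Module.finrank_fin_fun] at h1
  exact hx.symm.le.trans h1

theorem HasRank.exists_differentialAt_ne_zero {f : X → Y} {r : ℕ} (hr : HasRank (n := n) (m := m) f r)
    (h0 : r ≠ 0) : ∃ x : X, differentialAt (n := n) (m := m) f x ≠ 0 := by
  obtain ⟨x, hx⟩ := hr.1
  refine ⟨x, fun hd => h0 ?_⟩
  have h1 : Module.finrank ℂ (LinearMap.range
    (differentialAt (n := n) (m := m) f x : (Fin n → ℂ) →ₗ[ℂ] (Fin m → ℂ))) = r := hx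
  rw [← h1, hd]
  simp

variable [IsManifold 𝓘(ℂ, Fin n → ℂ) 1 X] [IsManifold 𝓘(ℂ, Fin m → ℂ) 1 Y] {f : X → Y}
  (g : HermitianMetric n X) (h : HermitianMetric m Y)

theorem energyDensity_eq_trace (hf : MDifferentiable 𝓘(ℂ, Fin n → ℂ) 𝓘(ℂ, Fin m → ℂ) f) (x : X)
    {z : Fin n → ℂ} (hz : z = chartAt (Fin n → ℂ) x x) :
    energyDensity g h f x = ((g.coeff x z)⁻¹ * (jacobian m f x z *
        (h.coeff (f x) (coordMap f x z) * (jacobian m f x z)ᴴ))).trace.re := by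
  have h1 := energyDensity_chartAt_symm g h hf (hz ▸ mem_coordDomain_self f x)
  rwa [hz, (chartAt (Fin n → ℂ) x).left_inv (mem_chart_source _ x), ← hz] at h1

/-- Near x the density agrees with `coordEnergy` in the fixed chart at x, although its definition
changes chart from point to point. -/
theorem continuous_energyDensity (hf : MDifferentiable 𝓘(ℂ, Fin n → ℂ) 𝓘(ℂ, Fin m → ℂ) f) :
    Continuous (energyDensity g h f) := by
  refine continuous_iff_continuousAt.2 fun x => ?_
  have hU := isOpen_coordDomain (n := n) (m := m) (x₀ := x) hf.continuous
  have hx := mem_coordDomain_self (n := n) (m := m) f x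
  have hc : ContinuousAt (chartAt (Fin n → ℂ) x) x :=
    (chartAt (Fin n → ℂ) x).continuousAt (mem_chart_source _ x)
  have hE : ContinuousAt (coordEnergy g h f x) (chartAt (Fin n → ℂ) x x) :=
    (contDiffOn_coordEnergy g h hf).continuousOn.continuousAt (hU.mem_nhds hx)
  refine (Complex.continuous_re.continuousAt.comp (hE.comp hc)).congr ?_
  filter_upwards [hc (hU.mem_nhds hx), chart_source_mem_nhds (Fin n → ℂ) x] with y hy hys
  have h1 := energyDensity_eq_coordEnergy g h hf hy
  rw [(chartAt (Fin n → ℂ) x).left_inv hys] at h1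
  simp [← h1]

theorem energyDensity_pos (hf : MDifferentiable 𝓘(ℂ, Fin n → ℂ) 𝓘(ℂ, Fin m → ℂ) f) {x : X}
    (hx : differentialAt (n := n) (m := m) f x ≠ 0) : 0 < energyDensity g h f x := by
  set z := chartAt (Fin n → ℂ) x x with hz
  have hzd : z ∈ coordDomain (n := n) m f x := mem_coordDomain_self f x
  rw [energyDensity_eq_trace g h hf x hz]
  refine trace_mul_pullback_pos (g.coeff_posDef hzd.1).inv
    (h.coeff_posDef (coordMap_mem_target hzd)) fun hK => hx ?_
  ext1 v
  have h1 := differentialAt_chartSymmDeriv hf hzd v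
  rw [chartSymmDeriv_self, (chartAt (Fin n → ℂ) x).left_inv (mem_chart_source _ x)] at h1
  have h2 : fderiv ℂ (coordMap (n := n) (m := m) f x) z v = 0 := by
    rw [← sum_smul_single v, map_sum]
    refine Finset.sum_eq_zero fun i _ => ?_
    have h3 : fderiv ℂ (coordMap (n := n) (m := m) f x) z (Pi.single i 1) = 0 :=
      congrFun hK i
    rw [map_smul, h3, smul_zero]
  rw [h1, h2, map_zero]
  rfl

/-- The Bochner inequality for the energy density. -/
theorem bochner_inequality (hf : MDifferentiable 𝓘(ℂ, Fin n → ℂ) 𝓘(ℂ, Fin m → ℂ) f) {r : ℕ}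
    (hr : HasRank (n := n) (m := m) f r) {τ C₁ C₂ κ₀ : ℝ} (hτ : 0 < τ) (hC₂ : 0 ≤ C₂)
    (hκ₀ : 0 ≤ κ₀) (hRic : TemperedRicciLowerBound g h f τ C₁ C₂)
    (hRBC : TemperedRBCUpperBound h τ (-κ₀)) (x : X) :
    -C₁ * energyDensity g h f x + (κ₀ / r + C₂ / n) * energyDensity g h f x ^ 2 ≤
      g.laplacian (energyDensity g h f) x := by
  set z := chartAt (Fin n → ℂ) x x with hz
  have hzd : z ∈ coordDomain (n := n) m f x := mem_coordDomain_self f x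
  obtain ⟨P, hP⟩ : ∃ P, P = jacobian m f x z *
    (h.coeff (f x) (coordMap f x z) * (jacobian m f x z)ᴴ) := ⟨_, rfl⟩
  have h1 := le_laplacian_energyDensity g h hf hτ hRic hRBC x hz hP
  have h2 : energyDensity g h f x = ((g.coeff x z)⁻¹ * P).trace.re := by
    rw [hP]; exact energyDensity_eq_trace g h hf x hz
  have hPh : P.IsHermitian := by
    rw [hP]; exact isHermitian_pullback (h.coeff_posDef (coordMap_mem_target hzd)).isHermitian
  have hrank : P.rank ≤ r := by
    rw [hP]; exact (Matrix.rank_mul_le_left _ _).trans (rank_jacobian_le hf hr hzd)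
  have hg := (g.coeff_posDef hzd.1).inv.posSemidef
  have h3 := trace_mul_sq_le_rank_mul hg hPh hrank
  -- Using r + 1 in place of r gives Θ ≥ 0 even when r = 0.
  have h4 := trace_mul_sq_le_rank_mul hg hPh (hrank.trans r.le_succ)
  rw [← h2] at h1 h3 h4
  set e := energyDensity g h f x
  set Θ := (P * ((g.coeff x z)⁻¹ * P * (g.coeff x z)⁻¹)).trace.re
  have hΘ : 0 ≤ Θ := by
    have h5 : (0 : ℝ) < (r.succ : ℕ) := by exact_mod_cast r.succ_pos
    exact nonneg_of_mul_nonneg_right ((sq_nonneg e).trans h4) h5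
  have h6 : (κ₀ / r + C₂ / n) * e ^ 2 ≤ (κ₀ + C₂) * Θ := by
    rcases Nat.eq_zero_or_pos r with hr0 | hr0
    · have h7 : e ^ 2 = 0 := le_antisymm (by simpa [hr0] using h3) (sq_nonneg e)
      rw [h7, mul_zero]
      positivity
    · have hr1 : (0 : ℝ) < r := by exact_mod_cast hr0
      have hn1 : (r : ℝ) ≤ n := by exact_mod_cast hr.le_left
      have h8 : κ₀ / r * e ^ 2 ≤ κ₀ * Θ := by
        rw [div_mul_eq_mul_div, div_le_iff₀ hr1]
        nlinarith
      -- Here e² ≤ rΘ is weakened to e² ≤ nΘ.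
      have h9 : C₂ / n * e ^ 2 ≤ C₂ * Θ := by
        rw [div_mul_eq_mul_div, div_le_iff₀ (hr1.trans_le hn1)]
        have h10 : (r : ℝ) * Θ ≤ n * Θ := mul_le_mul_of_nonneg_right hn1 hΘ
        nlinarith
      linarith
  linarith

/-- The Schwarz lemma: an upper bound for the energy density on a compact manifold. -/
theorem energyDensity_le [CompactSpace X]
    (hf : MDifferentiable 𝓘(ℂ, Fin n → ℂ) 𝓘(ℂ, Fin m → ℂ) f) {r : ℕ}
    (hr : HasRank (n := n) (m := m) f r) {τ C₁ C₂ κ₀ : ℝ} (hτ : 0 < τ) (hC₂ : 0 ≤ C₂)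
    (hκ₀ : 0 ≤ κ₀) (hRic : TemperedRicciLowerBound g h f τ C₁ C₂)
    (hRBC : TemperedRBCUpperBound h τ (-κ₀)) (hpos : 0 < κ₀ * n + r * C₂) (x : X) :
    energyDensity g h f x ≤ C₁ * r * n / (κ₀ * n + r * C₂) := by
  obtain ⟨x₁, -, hx₁⟩ := isCompact_univ.exists_isMaxOn ⟨x, mem_univ x⟩
    (continuous_energyDensity g h hf).continuousOn
  have hmax : ∀ y, energyDensity g h f y ≤ energyDensity g h f x₁ := fun y => hx₁ (mem_univ y)
  have hzd : chartAt (Fin n → ℂ) x₁ x₁ ∈ coordDomain (n := n) m f x₁ := mem_coordDomain_self f x₁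
  have hU := isOpen_coordDomain (n := n) (m := m) (x₀ := x₁) hf.continuous
  have hlap : g.laplacian (energyDensity g h f) x₁ ≤ 0 := by
    refine g.laplacian_nonpos_of_isLocalMax ?_ ?_
    · have hsm : ContDiffAt ℝ 2 (coordEnergy g h f x₁) (chartAt (Fin n → ℂ) x₁ x₁) :=
        ((contDiffOn_coordEnergy g h hf).contDiffAt (hU.mem_nhds hzd)).of_le ENat.LEInfty.out
      refine hsm.congr_of_eventuallyEq ?_
      filter_upwards [hU.mem_nhds hzd] with w hw using energyDensity_eq_coordEnergy g h hf hw
    · refine Eventually.of_forall fun w => ?_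
      beta_reduce
      rw [(chartAt (Fin n → ℂ) x₁).left_inv (mem_chart_source _ x₁)]
      exact hmax _
  have hboch := (bochner_inequality g h hf hr hτ hC₂ hκ₀ hRic hRBC x₁).trans hlap
  refine (hmax x).trans ?_
  -- For r = 0 the energy and the bound both vanish; for r > 0 the maximum is positive, so the
  -- inequality can be divided by it.
  rcases Nat.eq_zero_or_pos r with hr0 | hr0
  · have h0 : energyDensity g h f x₁ ^ 2 ≤ 0 := by
      have hz := energyDensity_eq_trace g h hf x₁ rfl
      rw [hz]
      have h3 := trace_mul_sq_le_rank_mul (g.coeff_posDef hzd.1).inv.posSemidef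
        (isHermitian_pullback (h.coeff_posDef (coordMap_mem_target hzd)).isHermitian)
        ((Matrix.rank_mul_le_left _ _).trans (rank_jacobian_le hf hr hzd))
      simpa [hr0] using h3
    have h1 : energyDensity g h f x₁ = 0 := pow_eq_zero_iff two_ne_zero |>.1
      (le_antisymm h0 (sq_nonneg _))
    rw [h1, hr0]
    simp
  · obtain ⟨x₂, hx₂⟩ := hr.exists_differentialAt_ne_zero hr0.ne'
    have he : 0 < energyDensity g h f x₁ := (energyDensity_pos g h hf hx₂).trans_le (hmax x₂)
    have hr1 : (0 : ℝ) < r := by exact_mod_cast hr0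
    have hn1 : (0 : ℝ) < n := by exact_mod_cast hr0.trans_le hr.le_left
    set e := energyDensity g h f x₁
    have h1 : (κ₀ / r + C₂ / n) * e ≤ C₁ := by
      by_contra! hlt
      nlinarith
    have h2 : κ₀ / r + C₂ / n = (κ₀ * n + r * C₂) / (r * n) := by
      field_simp
    rw [h2, div_mul_eq_mul_div, div_le_iff₀ (by positivity)] at h1
    rw [le_div_iff₀ hpos]
    linarith

end Energy

end HermitianGeometry

theorem theorem1p2 {n m r : ℕ} {X Y : Type*}
    [TopologicalSpace X] [ChartedSpace (Fin n → ℂ) X] [IsManifold 𝓘(ℂ, Fin n → ℂ) ω X]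
    [TopologicalSpace Y] [ChartedSpace (Fin m → ℂ) Y] [IsManifold 𝓘(ℂ, Fin m → ℂ) ω Y]
    (g : HermitianGeometry.HermitianMetric n X) (h : HermitianGeometry.HermitianMetric m Y)
    (f : X → Y) (hf : MDifferentiable 𝓘(ℂ, Fin n → ℂ) 𝓘(ℂ, Fin m → ℂ) f)
    (hr : HermitianGeometry.HasRank (n := n) (m := m) f r)
    (τ C₁ C₂ κ₀ : ℝ) (hτ : 0 < τ) (hC₂ : 0 ≤ C₂) (hκ₀ : 0 ≤ κ₀)
    (hRic : HermitianGeometry.TemperedRicciLowerBound g h f τ C₁ C₂)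
    (hRBC : HermitianGeometry.TemperedRBCUpperBound h τ (-κ₀)) :
    (∀ x : X,
      -C₁ * HermitianGeometry.energyDensity g h f x
          + (κ₀ / r + C₂ / n) * (HermitianGeometry.energyDensity g h f x) ^ 2
        ≤ g.laplacian (HermitianGeometry.energyDensity g h f) x) ∧
    (CompactSpace X → 0 < κ₀ * n + r * C₂ →
      ∀ x : X, HermitianGeometry.energyDensity g h f x ≤ C₁ * r * n / (κ₀ * n + r * C₂)) := by
  -- Complex C¹ charts suffice for the argument, holomorphic maps being smooth.
  have : IsManifold 𝓘(ℂ, Fin n → ℂ) 1 X := IsManifold.of_le (n := ω) le_top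
  have : IsManifold 𝓘(ℂ, Fin m → ℂ) 1 Y := IsManifold.of_le (n := ω) le_top
  exact ⟨fun x => HermitianGeometry.bochner_inequality g h hf hr hτ hC₂ hκ₀ hRic hRBC x,
    fun _ hpos x => HermitianGeometry.energyDensity_le g h hf hr hτ hC₂ hκ₀ hRic hRBC hpos x⟩
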